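/- Let $g\ge 3$. A loop of loops of genus $g$ is a metric graph $\Gamma$ with $2g-2$ vertices $v_1,\dots,v_{g-1},w_1,\dots,w_{g-1}$ and with edges of arbitrary positive real lengths: one edge joining $v_i$ to $w_i$ for $1\le i\le g-1$, two edges joining $w_i$ to $v_{i+1}$ for $1\le i\le g-2$, and two edges joining $w_{g-1}$ to $v_1$. On a compact connected metric graph $\Gamma$, a divisor is a finite $\mathbb Z$-linear combination of points. It is effective if its coefficients are nonnegative, and its degree is the sum of its coefficients. Two divisors are equivalent if their difference is $\operatorname{div}(f)=\sum_{p\in\Gamma}\operatorname{ord}_p(f)\,p$ for some continuous piecewise linear function $f$ on $\Gamma$ with integer slopes, where $\operatorname{ord}_p(f)$ is the sum of the incoming slopes of $f$ at $p$. For $A\subseteq\Gamma$, the $A$-rank $r_A(D)$ of a divisor $D$ is $-1$ if $D$ is not equivalent to an effective divisor; otherwise it is the largest integer $r$ such that for every effective divisor $E$ of degree $r$ with support in $A$ there is a divisor $D'$ equivalent to $D$ with $D'-E$ effective ($+\infty$ if there is no largest such $r$). The rank is $r(D)=r_\Gamma(D)$. The set $A$ is rank determining if $r_A(D)=r(D)$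 for all divisors $D$ on $\Gamma$, and minimal rank determining if moreover no proper subset of $A$ is rank determining. The genus of $\Gamma$ is its first Betti number. **Theorem.** (1) Let $g\ge 3$ and let $\Gamma$ be a loop of loops of genus $g$. Then $\Gamma$ has first Betti number $g$, the set $A=\{v_1,w_1,\dots,v_{g-1},w_{g-1}\}$ is exactly the set of points of valence $3$ of $\Gamma$, it has $2g-2$ elements, and it is a minimal rank determining set on $\Gamma$. If $g\ge 4$, then $|A|=2g-2>g+1$. (2) Consequently Luo's conjecture, that every minimal rank determining set on a metric graph of genus $g$ has at most $g+1$ elements, is false (already for finite sets). -/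

import Mathlib

open Filter Topology

/-- A compact connected metric graph, presented by a finite connected multigraph (loops and
multiple edges allowed) whose edges carry positive real lengths. The edge `e` is the segment
`[0, len e]`, with `0` glued to the vertex `src e` and `len e` glued to the vertex `tgt e`;
the orientation is auxiliary. -/
structure MetricGraph where
  V : Type
  E : Type
  [finV : Fintype V]
  [finE : Fintype E]
  src : E → V
  tgt : E → V
  len : E → ℝ
  len_pos : ∀ e, 0 < len e
  nonempty : Nonempty V
  connected : ∀ a b : V, Relation.EqvGen (fun x y => ∃ e, src e = x ∧ tgt e = y) a b

attribute [instance] MetricGraph.finV MetricGraph.finE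

namespace MetricGraph

/-- The points of the metric graph: the vertices, and the interior points of the edges. -/
inductive Point (Γ : MetricGraph) : Type
  | vertex (v : Γ.V) : Point Γ
  | inner (e : Γ.E) (t : ℝ) (ht : t ∈ Set.Ioo 0 (Γ.len e)) : Point Γ

/-- The parametrization `[0, len e] → Γ` of the edge `e` (constant outside `[0, len e]`). -/
noncomputable def edgePoint (Γ : MetricGraph) (e : Γ.E) (t : ℝ) : Γ.Point :=
  if h : t ∈ Set.Ioo 0 (Γ.len e) then .inner e t h
  else if t ≤ 0 then .vertex (Γ.src e) else .vertex (Γ.tgt e)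

open Classical in
/-- The number of tangent directions at a point; a loop counts twice at its vertex. -/
noncomputable def valence (Γ : MetricGraph) : Γ.Point → ℕ
  | .vertex v => (Finset.univ.filter fun e => Γ.src e = v).card
      + (Finset.univ.filter fun e => Γ.tgt e = v).card
  | .inner _ _ _ => 2

open Classical in
/-- The cellular boundary map `C₁(Γ, ℤ) → C₀(Γ, ℤ)`, sending `e` to `tgt e - src e`. -/
noncomputable def boundary (Γ : MetricGraph) : (Γ.E → ℤ) →ₗ[ℤ] (Γ.V → ℤ) :=
  ∑ e, (LinearMap.proj e).smulRight
    ((Pi.single (Γ.tgt e) 1 : Γ.V → ℤ) - (Pi.single (Γ.src e) 1 : Γ.V → ℤ))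

/-- The genus: the first Betti number, i.e. the rank of `H₁(Γ, ℤ) = ker ∂`. -/
noncomputable def genus (Γ : MetricGraph) : ℕ :=
  Module.finrank ℤ (LinearMap.ker Γ.boundary)

/-- Divisors: finite `ℤ`-linear combinations of points. -/
abbrev Divisor (Γ : MetricGraph) : Type := Γ.Point →₀ ℤ

/-- The degree of a divisor: the sum of its coefficients. -/
def degree {Γ : MetricGraph} (D : Γ.Divisor) : ℤ := D.sum fun _ a => a

/-- A divisor is effective if all its coefficients are nonnegative. -/
def Effective {Γ : MetricGraph} (D : Γ.Divisor) : Prop := ∀ p, 0 ≤ D p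

/-- `f` is affine near `t` on the side of `t` given by the filter `l` (`𝓝[<] t` or `𝓝[>] t`),
with slope `m` in the direction pointing towards `t`. -/
def HasInSlope (f : ℝ → ℝ) (t : ℝ) (l : Filter ℝ) (m : ℤ) : Prop :=
  ∀ᶠ s in l, f t = f s + (m : ℝ) * |t - s|

open Classical in
/-- Along every tangent direction at `p` the function `φ` is affine near `p` with integer slope,
and the sum of the incoming slopes of `φ` at `p` is `m`. -/
def HasOrd {Γ : MetricGraph} (φ : Γ.Point → ℝ) : Γ.Point → ℤ → Prop
  | .inner e t _, m => ∃ a b : ℤ,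
      HasInSlope (φ ∘ Γ.edgePoint e) t (𝓝[<] t) a ∧
      HasInSlope (φ ∘ Γ.edgePoint e) t (𝓝[>] t) b ∧ m = a + b
  | .vertex v, m => ∃ a b : Γ.E → ℤ,
      (∀ e, Γ.src e = v → HasInSlope (φ ∘ Γ.edgePoint e) 0 (𝓝[>] 0) (a e)) ∧
      (∀ e, Γ.tgt e = v →
        HasInSlope (φ ∘ Γ.edgePoint e) (Γ.len e) (𝓝[<] (Γ.len e)) (b e)) ∧
      m = ∑ e ∈ Finset.univ.filter (fun e => Γ.src e = v), a e
        + ∑ e ∈ Finset.univ.filter (fun e => Γ.tgt e = v), b e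

/-- `D` is the divisor of a continuous piecewise linear function `φ` with integer slopes.
By compactness of the edges, being affine with integer slope on both sides of every point is the
same as being continuous and piecewise linear with integer slopes and finitely many pieces. -/
def IsPrincipal {Γ : MetricGraph} (D : Γ.Divisor) : Prop :=
  ∃ φ : Γ.Point → ℝ, ∀ p, HasOrd φ p (D p)

/-- Linear equivalence of divisors. -/
def LinEquiv {Γ : MetricGraph} (D D' : Γ.Divisor) : Prop := IsPrincipal (D - D')

open Classical in
/-- The `A`-rank of `D`: `-1` if `D` is not equivalent to an effective divisor, and otherwise the
largest `r` such that for every effective divisor `E` of degree `r` with support in `A` there is a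
divisor `D'` equivalent to `D` with `D' - E` effective (`⊤` if these `r` are unbounded, which
happens only for `A = ∅`). -/
noncomputable def rankOn {Γ : MetricGraph} (A : Set Γ.Point) (D : Γ.Divisor) : WithTop ℤ :=
  if ∃ D' : Γ.Divisor, LinEquiv D D' ∧ Effective D' then
    sSup {x : WithTop ℤ | ∃ r : ℕ, x = ((r : ℤ) : WithTop ℤ) ∧
      ∀ E : Γ.Divisor, Effective E → degree E = (r : ℤ) → (E.support : Set Γ.Point) ⊆ A →
        ∃ D' : Γ.Divisor, LinEquiv D D' ∧ Effective (D' - E)}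
  else ((-1 : ℤ) : WithTop ℤ)

/-- The (Baker–Norine) rank of a divisor. -/
noncomputable def rank {Γ : MetricGraph} (D : Γ.Divisor) : WithTop ℤ := rankOn Set.univ D

/-- `A` is rank determining if the `A`-rank of every divisor is its rank. -/
def IsRankDetermining {Γ : MetricGraph} (A : Set Γ.Point) : Prop :=
  ∀ D : Γ.Divisor, rankOn A D = rank D

/-- `A` is rank determining and no proper subset of `A` is rank determining. -/
def IsMinimalRankDetermining {Γ : MetricGraph} (A : Set Γ.Point) : Prop :=
  IsRankDetermining A ∧ ∀ B : Set Γ.Point, B ⊂ A → ¬ IsRankDetermining B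

end MetricGraph

/-- Luo's conjecture: on a metric graph of genus `g`, every minimal (finite) rank determining set
has at most `g + 1` elements. -/
def LuoConjecture : Prop :=
  ∀ (Γ : MetricGraph) (A : Finset Γ.Point),
    MetricGraph.IsMinimalRankDetermining (A : Set Γ.Point) → A.card ≤ Γ.genus + 1

namespace LoopOfLoops

/-- The vertices of a loop of `n` loops: `v_i` is `.inl i` and `w_i` is `.inr i`. -/
abbrev Vertex (n : ℕ) : Type := Fin n ⊕ Fin n

/-- The edges of a loop of `n` loops: `.inl i` joins `v_i` to `w_i`, and the two edges
`.inr (i, 0)` and `.inr (i, 1)` join `w_i` to `v_{i+1}`, where the index is cyclic, so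
that for the last `i` they join `w_i` to the first `v`. -/
abbrev Edge (n : ℕ) : Type := Fin n ⊕ Fin n × Fin 2

/-- One end of each edge. -/
def src {n : ℕ} : Edge n → Vertex n
  | .inl i => .inl i
  | .inr (i, _) => .inr i

/-- The other end of each edge; `finRotate n` is the cyclic shift `i ↦ i + 1`. -/
def tgt {n : ℕ} : Edge n → Vertex n
  | .inl i => .inr i
  | .inr (i, _) => .inl (finRotate n i)

theorem connected (n : ℕ) (a b : Vertex n) :
    Relation.EqvGen (fun x y => ∃ e : Edge n, src e = x ∧ tgt e = y) a b := by
  cases n with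
  | zero => rcases a with a | a <;> exact a.elim0
  | succ n =>
    have hvw : ∀ i : Fin (n + 1), Relation.EqvGen
        (fun x y => ∃ e : Edge (n + 1), src e = x ∧ tgt e = y) (.inl i) (.inr i) :=
      fun i => .rel _ _ ⟨.inl i, rfl, rfl⟩
    have hwv : ∀ i : Fin (n + 1), Relation.EqvGen
        (fun x y => ∃ e : Edge (n + 1), src e = x ∧ tgt e = y)
        (.inr i) (.inl (finRotate (n + 1) i)) :=
      fun i => .rel _ _ ⟨.inr (i, 0), rfl, rfl⟩
    have hv : ∀ i : Fin (n + 1), Relation.EqvGen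
        (fun x y => ∃ e : Edge (n + 1), src e = x ∧ tgt e = y) (.inl 0) (.inl i) := by
      intro i
      induction i using Fin.induction with
      | zero => exact .refl _
      | succ i ih =>
        have h := ((ih.trans _ _ _ (hvw _)).trans _ _ _ (hwv _))
        rwa [finRotate_apply, Fin.coeSucc_eq_succ] at h
    have hall : ∀ c : Vertex (n + 1), Relation.EqvGen
        (fun x y => ∃ e : Edge (n + 1), src e = x ∧ tgt e = y) (.inl 0) c := by
      rintro (i | i)
      · exact hv i
      · exact (hv i).trans _ _ _ (hvw i)
    exact ((hall a).symm _ _).trans _ _ _ (hall b)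

end LoopOfLoops

/-- The loop of loops of genus `g` with arbitrary positive edge lengths. It has the `2g - 2`
vertices `v_1, …, v_{g-1}, w_1, …, w_{g-1}` (indexed here from `0`), one edge joining `v_i` to
`w_i`, two edges joining `w_i` to `v_{i+1}`, and two edges joining `w_{g-1}` to `v_1`. -/
abbrev loopOfLoops (g : ℕ) (hg : 3 ≤ g) (len : LoopOfLoops.Edge (g - 1) → ℝ)
    (hlen : ∀ e, 0 < len e) : MetricGraph where
  V := LoopOfLoops.Vertex (g - 1)
  E := LoopOfLoops.Edge (g - 1)
  src := LoopOfLoops.src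
  tgt := LoopOfLoops.tgt
  len := len
  len_pos := hlen
  nonempty := ⟨.inl ⟨0, by omega⟩⟩
  connected := LoopOfLoops.connected (g - 1)

/-- The set `{v_1, w_1, …, v_{g-1}, w_{g-1}}` in the loop of loops. -/
def loopOfLoopsVertices (g : ℕ) (hg : 3 ≤ g) (len : LoopOfLoops.Edge (g - 1) → ℝ)
    (hlen : ∀ e, 0 < len e) : Set (loopOfLoops g hg len hlen).Point :=
  Set.range fun x : LoopOfLoops.Vertex (g - 1) =>
    (MetricGraph.Point.vertex x : (loopOfLoops g hg len hlen).Point)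

/-! The vertices of any metric graph presented without loop edges are rank determining
(`isRankDetermining_vertices`). By induction on the degree of `E` only a single chip has to be
treated (`Reaches.univ`). Suppose a class has effective members `D₁` and `D₂` with a chip at the one
and at the other end of an edge, and `D₂ - D₁ = div φ`. Truncating `φ` at its value at an interior
point `x` gives an effective divisor with a chip at `x` or chips on both sides of `x` on the edge;
in the latter case the two chips slide towards each other until one of them hits `x`
(`exists_ge_one_of_vertices`).

For minimality it suffices to find, for each vertex, an effective divisor whose class reaches all
other vertices but not this one. Put `n = g - 1` and label the graph as `p 0 - q 0 = p 1 - q 1 = ⋯`,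
where `p 0` is the chosen vertex; the divisor is `2 q 0 + q 1 + ⋯ + q (n - 1)`. A fire started at `p
0` burns `q (n - 1)` through two parallel edges against one chip, then the empty `p (n - 1)`, and so
on down to `p 1`; then `q 0` burns through three edges against two chips. By Dhar's criterion
(`exists_firing_set`) `p 0` is out of reach (`chips_unreachable`).

To reach `p (K + 1)`, let both spare chips leave `q 0` towards `p 1`. The one on the shorter edge
runs on to `q 1`, where it and the chip of `q 1` again make two, and so on; meanwhile the chip of `q
(K + 1)` approaches `p (K + 1)` along the single edge. The motion stops when a chip arrives. It is
encoded by a distance function truncated at the arrival time (`chips_reach_p`).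

Every `v_i` can serve as `p 0`, and so can every `w_i` after reversing the cyclic direction. The
genus follows from the Euler characteristic, and `2g - 2 > g + 1` once `g ≥ 4`. -/

namespace MetricGraph

/-! ### One-sided integer slopes of real functions. -/

theorem HasInSlope.add {f g : ℝ → ℝ} {t : ℝ} {l : Filter ℝ} {a b : ℤ}
    (hf : HasInSlope f t l a) (hg : HasInSlope g t l b) :
    HasInSlope (fun s => f s + g s) t l (a + b) := by
  filter_upwards [hf, hg] with s h1 h2
  push_cast
  linear_combination h1 + h2

theorem HasInSlope.neg {f : ℝ → ℝ} {t : ℝ} {l : Filter ℝ} {a : ℤ}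
    (hf : HasInSlope f t l a) : HasInSlope (fun s => -f s) t l (-a) := by
  filter_upwards [hf] with s h1
  push_cast
  linear_combination -h1

theorem hasInSlope_const (c t : ℝ) (l : Filter ℝ) : HasInSlope (fun _ => c) t l 0 :=
  Eventually.of_forall fun _ => by simp

theorem HasInSlope.congr {f g : ℝ → ℝ} {t : ℝ} {l : Filter ℝ} {a : ℤ}
    (hf : HasInSlope f t l a) (h : f =ᶠ[l] g) (ht : f t = g t) : HasInSlope g t l a := by
  filter_upwards [hf, h] with s h1 h2
  rw [← ht, ← h2, h1]

theorem HasInSlope.unique {f : ℝ → ℝ} {t : ℝ} {l : Filter ℝ} [l.NeBot] (hl : l ≤ 𝓝[≠] t)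
    {a b : ℤ} (ha : HasInSlope f t l a) (hb : HasInSlope f t l b) : a = b := by
  obtain ⟨s, h1, h2, h3⟩ := (ha.and (hb.and (hl self_mem_nhdsWithin))).exists
  have h4 : |t - s| ≠ 0 := abs_ne_zero.2 (sub_ne_zero.2 (Ne.symm h3))
  have h5 : (a : ℝ) = b := mul_right_cancel₀ h4 (by linarith)
  exact_mod_cast h5

theorem HasInSlope.tendsto {f : ℝ → ℝ} {t : ℝ} {l : Filter ℝ} {a : ℤ}
    (hf : HasInSlope f t l a) (hl : l ≤ 𝓝 t) : Tendsto f l (𝓝 (f t)) := by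
  have h1 : Tendsto (fun s : ℝ => f t - a * |t - s|) (𝓝 t) (𝓝 (f t - a * |t - t|)) :=
    (Continuous.tendsto (by fun_prop) t)
  rw [sub_self, abs_zero, mul_zero, sub_zero] at h1
  refine (h1.mono_left hl).congr' ?_
  filter_upwards [hf] with s hs
  linarith

theorem HasInSlope.min_of_lt {f g : ℝ → ℝ} {t : ℝ} {l : Filter ℝ} {a b : ℤ} (hl : l ≤ 𝓝 t)
    (hf : HasInSlope f t l a) (hg : HasInSlope g t l b) (h : f t < g t) :
    HasInSlope (fun s => min (f s) (g s)) t l a := by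
  refine hf.congr ?_ (min_eq_left h.le).symm
  filter_upwards [(hf.tendsto hl).eventually_lt (hg.tendsto hl) h] with s hs
  exact (min_eq_left hs.le).symm

/-- Slopes are measured towards `t`, so of two functions agreeing at `t` the one with the larger
incoming slope is the smaller one nearby. -/
theorem HasInSlope.min_of_eq {f g : ℝ → ℝ} {t : ℝ} {l : Filter ℝ} {a b : ℤ}
    (hf : HasInSlope f t l a) (hg : HasInSlope g t l b) (h : f t = g t) :
    HasInSlope (fun s => min (f s) (g s)) t l (max a b) := by
  filter_upwards [hf, hg] with s h1 h2
  have h3 : f s = f t - a * |t - s| := by linarith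
  have h4 : g s = f t - b * |t - s| := by linarith
  have h5 := abs_nonneg (t - s)
  rw [← h, min_self, h3, h4]
  rcases le_total a b with hab | hab
  · have : (a : ℝ) ≤ b := by exact_mod_cast hab
    rw [max_eq_right hab, min_eq_right (by nlinarith)]; ring
  · have : (b : ℝ) ≤ a := by exact_mod_cast hab
    rw [max_eq_left hab, min_eq_left (by nlinarith)]; ring

theorem hasInSlope_left_affine (k : ℤ) (b t : ℝ) :
    HasInSlope (fun s => k * s + b) t (𝓝[<] t) k := by
  filter_upwards [self_mem_nhdsWithin] with s (hs : s < t)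
  rw [abs_of_pos (sub_pos.2 hs)]; ring

theorem hasInSlope_right_affine (k : ℤ) (b t : ℝ) :
    HasInSlope (fun s => k * s + b) t (𝓝[>] t) (-k) := by
  filter_upwards [self_mem_nhdsWithin] with s (hs : t < s)
  rw [abs_of_neg (sub_neg.2 hs)]; push_cast; ring

theorem HasInSlope.reflect_right {f : ℝ → ℝ} {t c : ℝ} {m : ℤ}
    (h : HasInSlope (fun s => f (c - s)) (c - t) (𝓝[>] (c - t)) m) :
    HasInSlope f t (𝓝[<] t) m := by
  have h1 : Tendsto (fun s : ℝ => c - s) (𝓝[<] t) (𝓝[>] (c - t)) := by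
    refine tendsto_nhdsWithin_iff.2 ⟨?_, ?_⟩
    · exact (Continuous.tendsto (by fun_prop) t).mono_left nhdsWithin_le_nhds
    · filter_upwards [self_mem_nhdsWithin] with s (hs : s < t)
      exact sub_lt_sub_left hs c
  filter_upwards [h1.eventually h] with s hs
  simp only [sub_sub_cancel] at hs
  rw [hs, abs_sub_comm t s]
  congr 3; ring

theorem HasInSlope.reflect_left {f : ℝ → ℝ} {t c : ℝ} {m : ℤ}
    (h : HasInSlope f t (𝓝[<] t) m) :
    HasInSlope (fun s => f (c - s)) (c - t) (𝓝[>] (c - t)) m := by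
  have h1 : Tendsto (fun s : ℝ => c - s) (𝓝[>] (c - t)) (𝓝[<] t) := by
    refine tendsto_nhdsWithin_iff.2 ⟨?_, ?_⟩
    · have := (Continuous.tendsto (f := fun s : ℝ => c - s) (by fun_prop) (c - t))
      rw [sub_sub_cancel] at this
      exact this.mono_left nhdsWithin_le_nhds
    · filter_upwards [self_mem_nhdsWithin] with s (hs : c - t < s)
      show c - s < t
      linarith
  filter_upwards [h1.eventually h] with s hs
  simp only [sub_sub_cancel]
  rw [hs, abs_sub_comm (c - t) s]
  congr 3; ring

/-- If `f` has a slope at `t` from the right, then it is affine around every nearby point on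
the right of `t`. -/
theorem HasInSlope.eventually_right {f : ℝ → ℝ} {t : ℝ} {m : ℤ}
    (h : HasInSlope f t (𝓝[>] t) m) :
    ∀ᶠ s in 𝓝[>] t, HasInSlope f s (𝓝[<] s) (-m) ∧ HasInSlope f s (𝓝[>] s) m := by
  filter_upwards [h, eventually_eventually_nhdsWithin.2 h, self_mem_nhdsWithin] with s h1 h2 hs
  have hs' : t < s := hs
  rw [isOpen_Ioi.nhdsWithin_eq hs] at h2
  have h3 : ∀ᶠ x in 𝓝 s, t < x := isOpen_Ioi.mem_nhds hs
  constructor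
  · filter_upwards [nhdsWithin_le_nhds h2, nhdsWithin_le_nhds h3, self_mem_nhdsWithin]
      with x hx htx (hxs : x < s)
    rw [abs_of_neg (sub_neg.2 htx)] at hx
    rw [abs_of_neg (sub_neg.2 hs')] at h1
    rw [abs_of_pos (sub_pos.2 hxs)]
    push_cast
    linarith
  · filter_upwards [nhdsWithin_le_nhds h2, nhdsWithin_le_nhds h3, self_mem_nhdsWithin]
      with x hx htx (hxs : s < x)
    rw [abs_of_neg (sub_neg.2 htx)] at hx
    rw [abs_of_neg (sub_neg.2 hs')] at h1
    rw [abs_of_neg (sub_neg.2 hxs)]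
    linarith

theorem HasInSlope.eventually_left {f : ℝ → ℝ} {t : ℝ} {m : ℤ}
    (h : HasInSlope f t (𝓝[<] t) m) :
    ∀ᶠ s in 𝓝[<] t, HasInSlope f s (𝓝[<] s) m ∧ HasInSlope f s (𝓝[>] s) (-m) := by
  filter_upwards [h, eventually_eventually_nhdsWithin.2 h, self_mem_nhdsWithin] with s h1 h2 hs
  have hs' : s < t := hs
  rw [isOpen_Iio.nhdsWithin_eq hs] at h2
  have h3 : ∀ᶠ x in 𝓝 s, x < t := isOpen_Iio.mem_nhds hs
  constructor
  · filter_upwards [nhdsWithin_le_nhds h2, nhdsWithin_le_nhds h3, self_mem_nhdsWithin]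
      with x hx htx (hxs : x < s)
    rw [abs_of_pos (sub_pos.2 htx)] at hx
    rw [abs_of_pos (sub_pos.2 hs')] at h1
    rw [abs_of_pos (sub_pos.2 hxs)]
    linarith
  · filter_upwards [nhdsWithin_le_nhds h2, nhdsWithin_le_nhds h3, self_mem_nhdsWithin]
      with x hx htx (hxs : s < x)
    rw [abs_of_pos (sub_pos.2 htx)] at hx
    rw [abs_of_pos (sub_pos.2 hs')] at h1
    rw [abs_of_neg (sub_neg.2 hxs)]
    push_cast
    linarith

/-! ### Edge parametrizations, tangent directions and orders. -/

variable {Γ : MetricGraph}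

theorem edgePoint_of_nonpos (e : Γ.E) {t : ℝ} (ht : t ≤ 0) :
    Γ.edgePoint e t = .vertex (Γ.src e) := by
  simp [edgePoint, ht, ht.not_gt]

theorem edgePoint_of_len_le (e : Γ.E) {t : ℝ} (ht : Γ.len e ≤ t) :
    Γ.edgePoint e t = .vertex (Γ.tgt e) := by
  simp [edgePoint, ht.not_gt, ((Γ.len_pos e).trans_le ht).not_ge]

theorem edgePoint_zero (e : Γ.E) : Γ.edgePoint e 0 = .vertex (Γ.src e) :=
  edgePoint_of_nonpos e le_rfl

theorem edgePoint_len (e : Γ.E) : Γ.edgePoint e (Γ.len e) = .vertex (Γ.tgt e) :=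
  edgePoint_of_len_le e le_rfl

theorem edgePoint_inner (e : Γ.E) {t : ℝ} (ht : t ∈ Set.Ioo 0 (Γ.len e)) :
    Γ.edgePoint e t = .inner e t ht := by
  rw [edgePoint, dif_pos ht]

/-- The tangent directions at a point. -/
def Dir : Γ.Point → Type
  | .vertex v => {e // Γ.src e = v} ⊕ {e // Γ.tgt e = v}
  | .inner _ _ _ => Bool

open Classical in
noncomputable instance instFintypeDir : (p : Γ.Point) → Fintype (Dir p)
  | .vertex v => inferInstanceAs (Fintype ({e // Γ.src e = v} ⊕ {e // Γ.tgt e = v}))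
  | .inner _ _ _ => inferInstanceAs (Fintype Bool)

/-- The incoming slope of `φ` along a tangent direction is `m`. -/
def DirSlope (φ : Γ.Point → ℝ) : (p : Γ.Point) → Dir p → ℤ → Prop
  | .vertex _, .inl e, m => HasInSlope (φ ∘ Γ.edgePoint e) 0 (𝓝[>] 0) m
  | .vertex _, .inr e, m => HasInSlope (φ ∘ Γ.edgePoint e) (Γ.len e) (𝓝[<] (Γ.len e)) m
  | .inner e t _, true, m => HasInSlope (φ ∘ Γ.edgePoint e) t (𝓝[<] t) m
  | .inner e t _, false, m => HasInSlope (φ ∘ Γ.edgePoint e) t (𝓝[>] t) m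

/-- Reduces statements about all four kinds of tangent direction to one statement about a punctured
one-sided filter on an edge. -/
theorem dirSlope_spec (p : Γ.Point) (d : Dir p) : ∃ (e : Γ.E) (t : ℝ) (l : Filter ℝ),
    l.NeBot ∧ l ≤ 𝓝[≠] t ∧ Γ.edgePoint e t = p ∧
    ∀ φ m, DirSlope φ p d m ↔ HasInSlope (φ ∘ Γ.edgePoint e) t l m := by
  rcases p with v | ⟨e, t, ht⟩
  · rcases d with ⟨e, rfl⟩ | ⟨e, rfl⟩
    · exact ⟨e, 0, 𝓝[>] 0, inferInstance, nhdsWithin_mono _ fun x hx => ne_of_gt hx,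
        edgePoint_zero e, fun _ _ => Iff.rfl⟩
    · exact ⟨e, Γ.len e, 𝓝[<] (Γ.len e), inferInstance,
        nhdsWithin_mono _ fun x hx => ne_of_lt hx, edgePoint_len e, fun _ _ => Iff.rfl⟩
  · cases d
    · exact ⟨e, t, 𝓝[>] t, inferInstance, nhdsWithin_mono _ fun x hx => ne_of_gt hx,
        edgePoint_inner e ht, fun _ _ => Iff.rfl⟩
    · exact ⟨e, t, 𝓝[<] t, inferInstance, nhdsWithin_mono _ fun x hx => ne_of_lt hx,
        edgePoint_inner e ht, fun _ _ => Iff.rfl⟩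

open Classical in
theorem sum_dir_vertex (v : Γ.V) (σ : Dir (.vertex v : Γ.Point) → ℤ) (a b : Γ.E → ℤ)
    (ha : ∀ e (h : Γ.src e = v), σ (.inl ⟨e, h⟩) = a e)
    (hb : ∀ e (h : Γ.tgt e = v), σ (.inr ⟨e, h⟩) = b e) :
    ∑ d, σ d = ∑ e ∈ Finset.univ.filter (fun e => Γ.src e = v), a e
        + ∑ e ∈ Finset.univ.filter (fun e => Γ.tgt e = v), b e := by
  refine (Fintype.sum_sum_type (α₁ := {e // Γ.src e = v}) (α₂ := {e // Γ.tgt e = v}) σ).trans ?_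
  congr 1
  · rw [Finset.sum_subtype (p := fun e => Γ.src e = v) _ (by simp)]
    exact Finset.sum_congr rfl fun e _ => ha e.1 e.2
  · rw [Finset.sum_subtype (p := fun e => Γ.tgt e = v) _ (by simp)]
    exact Finset.sum_congr rfl fun e _ => hb e.1 e.2

theorem hasOrd_iff (φ : Γ.Point → ℝ) (p : Γ.Point) (m : ℤ) :
    HasOrd φ p m ↔ ∃ σ : Dir p → ℤ, (∀ d, DirSlope φ p d (σ d)) ∧ m = ∑ d, σ d := by
  classical
  rcases p with v | ⟨e, t, ht⟩
  · constructor
    · rintro ⟨a, b, ha, hb, hm⟩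
      refine ⟨Sum.elim (fun e => a e) (fun e => b e), ?_, ?_⟩
      · rintro (⟨e, he⟩ | ⟨e, he⟩)
        · exact ha e he
        · exact hb e he
      · rw [hm]
        exact (sum_dir_vertex v _ a b (fun _ _ => rfl) (fun _ _ => rfl)).symm
    · rintro ⟨σ, hσ, hm⟩
      -- The value `0` on edges not incident to `v` is immaterial: the sums in `HasOrd` run over
      -- incident edges only.
      refine ⟨fun e => if h : Γ.src e = v then σ (.inl ⟨e, h⟩) else 0,
        fun e => if h : Γ.tgt e = v then σ (.inr ⟨e, h⟩) else 0, ?_, ?_, ?_⟩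
      · intro e he
        exact (congrArg (HasInSlope (φ ∘ Γ.edgePoint e) 0 (𝓝[>] 0)) (dif_pos he)).mpr
          (hσ (.inl ⟨e, he⟩))
      · intro e he
        exact (congrArg (HasInSlope (φ ∘ Γ.edgePoint e) (Γ.len e) (𝓝[<] (Γ.len e)))
          (dif_pos he)).mpr (hσ (.inr ⟨e, he⟩))
      · rw [hm]
        exact sum_dir_vertex v σ _ _ (fun _ h => by rw [dif_pos h]) (fun _ h => by rw [dif_pos h])
  · constructor
    · rintro ⟨a, b, ha, hb, hm⟩
      refine ⟨fun d : Bool => if d then a else b, ?_, ?_⟩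
      · rintro (_ | _)
        · exact hb
        · exact ha
      · rw [hm]
        exact (Fintype.sum_bool (fun d : Bool => if d then a else b)).symm
    · rintro ⟨σ, hσ, hm⟩
      exact ⟨σ true, σ false, hσ true, hσ false, hm.trans (Fintype.sum_bool σ)⟩

theorem HasOrd.add {φ ψ : Γ.Point → ℝ} {p : Γ.Point} {a b : ℤ} (hφ : HasOrd φ p a)
    (hψ : HasOrd ψ p b) : HasOrd (fun x => φ x + ψ x) p (a + b) := by
  rw [hasOrd_iff] at *
  obtain ⟨σ, hσ, rfl⟩ := hφ
  obtain ⟨τ, hτ, rfl⟩ := hψ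
  refine ⟨fun d => σ d + τ d, fun d => ?_, by rw [Finset.sum_add_distrib]⟩
  obtain ⟨e, t, l, -, -, -, h⟩ := dirSlope_spec p d
  exact (h _ _).2 (((h _ _).1 (hσ d)).add ((h _ _).1 (hτ d)))

theorem HasOrd.neg {φ : Γ.Point → ℝ} {p : Γ.Point} {a : ℤ} (hφ : HasOrd φ p a) :
    HasOrd (fun x => -φ x) p (-a) := by
  rw [hasOrd_iff] at *
  obtain ⟨σ, hσ, rfl⟩ := hφ
  refine ⟨fun d => -σ d, fun d => ?_, by rw [Finset.sum_neg_distrib]⟩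
  obtain ⟨e, t, l, -, -, -, h⟩ := dirSlope_spec p d
  exact (h _ _).2 ((h _ _).1 (hσ d)).neg

theorem hasOrd_const (c : ℝ) (p : Γ.Point) : HasOrd (fun _ => c) p 0 := by
  rw [hasOrd_iff]
  refine ⟨fun _ => 0, fun d => ?_, by simp⟩
  obtain ⟨e, t, l, -, -, -, h⟩ := dirSlope_spec p d
  exact (h _ _).2 (hasInSlope_const c t l)

theorem HasOrd.unique {φ : Γ.Point → ℝ} {p : Γ.Point} {a b : ℤ} (ha : HasOrd φ p a)
    (hb : HasOrd φ p b) : a = b := by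
  rw [hasOrd_iff] at *
  obtain ⟨σ, hσ, rfl⟩ := ha
  obtain ⟨τ, hτ, rfl⟩ := hb
  refine Finset.sum_congr rfl fun d _ => ?_
  obtain ⟨e, t, l, _, hl, -, h⟩ := dirSlope_spec p d
  exact ((h _ _).1 (hσ d)).unique hl ((h _ _).1 (hτ d))

/-! ### Linear equivalence, and finiteness of the support of `div φ`. -/

theorem LinEquiv.refl (D : Γ.Divisor) : LinEquiv D D :=
  ⟨fun _ => 0, fun p => by simpa using hasOrd_const 0 p⟩

theorem LinEquiv.symm {D D' : Γ.Divisor} (h : LinEquiv D D') : LinEquiv D' D := by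
  obtain ⟨φ, hφ⟩ := h
  exact ⟨fun x => -φ x, fun p => by simpa using (hφ p).neg⟩

theorem LinEquiv.trans {D D' D'' : Γ.Divisor} (h : LinEquiv D D') (h' : LinEquiv D' D'') :
    LinEquiv D D'' := by
  obtain ⟨φ, hφ⟩ := h
  obtain ⟨ψ, hψ⟩ := h'
  exact ⟨fun x => φ x + ψ x, fun p => by simpa using (hφ p).add (hψ p)⟩

theorem LinEquiv.add_right {D D' : Γ.Divisor} (h : LinEquiv D D') (F : Γ.Divisor) :
    LinEquiv (D + F) (D' + F) := by
  simpa [LinEquiv] using h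

theorem LinEquiv.sub_right {D D' : Γ.Divisor} (h : LinEquiv D D') (F : Γ.Divisor) :
    LinEquiv (D - F) (D' - F) := by
  simpa [LinEquiv] using h

/-- Arbitrary real `x` is allowed because `edgePoint` is constant beyond the ends of the edge; this
spares later arguments a case distinction. -/
theorem exists_slope_left {φ : Γ.Point → ℝ} (h : ∀ p, ∃ m, HasOrd φ p m) (e : Γ.E) (x : ℝ) :
    ∃ a, HasInSlope (φ ∘ Γ.edgePoint e) x (𝓝[<] x) a := by
  rcases le_or_gt x 0 with h0 | h0
  · refine ⟨0, (hasInSlope_const (φ (.vertex (Γ.src e))) x _).congr ?_ ?_⟩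
    · filter_upwards [self_mem_nhdsWithin] with y (hy : y < x)
      rw [Function.comp_apply, edgePoint_of_nonpos e (hy.le.trans h0)]
    · rw [Function.comp_apply, edgePoint_of_nonpos e h0]
  rcases lt_trichotomy x (Γ.len e) with h1 | rfl | h1
  · obtain ⟨m, a, b, ha, -, -⟩ := h (.inner e x ⟨h0, h1⟩)
    exact ⟨a, ha⟩
  · obtain ⟨m, a, b, -, hb, -⟩ := h (.vertex (Γ.tgt e))
    exact ⟨b e, hb e rfl⟩
  · refine ⟨0, (hasInSlope_const (φ (.vertex (Γ.tgt e))) x _).congr ?_ ?_⟩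
    · filter_upwards [Ioo_mem_nhdsLT h1] with y hy
      rw [Function.comp_apply, edgePoint_of_len_le e hy.1.le]
    · rw [Function.comp_apply, edgePoint_of_len_le e h1.le]

theorem exists_slope_right {φ : Γ.Point → ℝ} (h : ∀ p, ∃ m, HasOrd φ p m) (e : Γ.E) (x : ℝ) :
    ∃ a, HasInSlope (φ ∘ Γ.edgePoint e) x (𝓝[>] x) a := by
  rcases le_or_gt (Γ.len e) x with h0 | h0
  · refine ⟨0, (hasInSlope_const (φ (.vertex (Γ.tgt e))) x _).congr ?_ ?_⟩
    · filter_upwards [self_mem_nhdsWithin] with y (hy : x < y)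
      rw [Function.comp_apply, edgePoint_of_len_le e (h0.trans hy.le)]
    · rw [Function.comp_apply, edgePoint_of_len_le e h0]
  rcases lt_trichotomy x 0 with h1 | rfl | h1
  · refine ⟨0, (hasInSlope_const (φ (.vertex (Γ.src e))) x _).congr ?_ ?_⟩
    · filter_upwards [Ioo_mem_nhdsGT h1] with y hy
      rw [Function.comp_apply, edgePoint_of_nonpos e hy.2.le]
    · rw [Function.comp_apply, edgePoint_of_nonpos e h1.le]
  · obtain ⟨m, a, b, ha, -, -⟩ := h (.vertex (Γ.src e))
    exact ⟨a e, ha e rfl⟩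
  · obtain ⟨m, a, b, -, hb, -⟩ := h (.inner e x ⟨h1, h0⟩)
    exact ⟨b, hb⟩

/-- The set of interior points of an edge where a piecewise linear function is not smooth
is finite. -/
theorem finite_singular {φ : Γ.Point → ℝ} (h : ∀ p, ∃ m, HasOrd φ p m) (e : Γ.E) :
    {t : ℝ | ∃ ht : t ∈ Set.Ioo 0 (Γ.len e), ¬ HasOrd φ (.inner e t ht) 0}.Finite := by
  by_contra hinf
  -- Infinitely many singular points would accumulate at some `x`, but having a slope on each side
  -- of `x` makes the function smooth in a punctured neighbourhood.
  obtain ⟨x, hx, hacc⟩ := Set.Infinite.exists_accPt_of_subset_isCompact hinf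
    (isCompact_Icc (a := (0 : ℝ)) (b := Γ.len e)) (fun t ht => Set.Ioo_subset_Icc_self ht.1)
  rw [accPt_iff_frequently] at hacc
  have hR' : ∀ᶠ s in 𝓝[>] x, ∀ ht : s ∈ Set.Ioo 0 (Γ.len e), HasOrd φ (.inner e s ht) 0 := by
    obtain ⟨m, hm⟩ := exists_slope_right h e x
    filter_upwards [hm.eventually_right] with s hs ht
    exact ⟨_, _, hs.1, hs.2, by ring⟩
  have hL' : ∀ᶠ s in 𝓝[<] x, ∀ ht : s ∈ Set.Ioo 0 (Γ.len e), HasOrd φ (.inner e s ht) 0 := by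
    obtain ⟨m, hm⟩ := exists_slope_left h e x
    filter_upwards [hm.eventually_left] with s hs ht
    exact ⟨_, _, hs.1, hs.2, by ring⟩
  have hev : ∀ᶠ s in 𝓝[≠] x, ∀ ht : s ∈ Set.Ioo 0 (Γ.len e), HasOrd φ (.inner e s ht) 0 := by
    rw [← Set.Iio_union_Ioi, nhdsWithin_union]
    exact eventually_sup.2 ⟨hL', hR'⟩
  rw [eventually_nhdsWithin_iff] at hev
  refine hacc (hev.mono fun s hs => ?_)
  rintro ⟨hne, ht, hno⟩
  exact hno (hs hne ht)

/-- A piecewise linear function has a divisor. -/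
theorem exists_divisor {φ : Γ.Point → ℝ} (h : ∀ p, ∃ m, HasOrd φ p m) :
    ∃ D : Γ.Divisor, ∀ p, HasOrd φ p (D p) := by
  choose m hm using h
  have hfin : (Function.support m).Finite := by
    have h1 : (Set.range (Point.vertex : Γ.V → Γ.Point) ∪ ⋃ e : Γ.E, Γ.edgePoint e ''
        {t : ℝ | ∃ ht : t ∈ Set.Ioo 0 (Γ.len e), ¬ HasOrd φ (.inner e t ht) 0}).Finite :=
      (Set.finite_range _).union
        (Set.finite_iUnion fun e => (finite_singular (fun p => ⟨m p, hm p⟩) e).image _)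
    refine h1.subset fun p hp => ?_
    rcases p with v | ⟨e, t, ht⟩
    · exact Or.inl ⟨v, rfl⟩
    · refine Or.inr (Set.mem_iUnion.2 ⟨e, t, ⟨ht, fun h0 => hp ?_⟩, edgePoint_inner e ht⟩)
      exact (hm _).unique h0
  exact ⟨Finsupp.ofSupportFinite m hfin, hm⟩

/-! ### Truncation of a function at a constant. -/

/-- On the level set `φ = c` every incoming slope `σ d` becomes `max (σ d) 0`. If these sum to `0`,
then all `σ d ≤ 0`; if the `σ d` also sum to `0`, they all vanish. This rigidity is what later
produces chips at the boundary of the level set. -/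
theorem HasOrd.min_const {φ : Γ.Point → ℝ} {p : Γ.Point} {a : ℤ} (h : HasOrd φ p a) (c : ℝ) :
    ∃ m, HasOrd (fun x => min (φ x) c) p m ∧ (φ p < c → m = a) ∧ (c < φ p → m = 0) ∧
      (φ p = c → 0 ≤ m ∧ a ≤ m ∧ (m = 0 → a = 0 → ∀ d, DirSlope φ p d 0)) := by
  obtain ⟨σ, hσ, rfl⟩ := (hasOrd_iff _ _ _).1 h
  rcases lt_trichotomy (φ p) c with hc | hc | hc
  · refine ⟨∑ d, σ d, (hasOrd_iff _ _ _).2 ⟨σ, fun d => ?_, rfl⟩, fun _ => rfl,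
      fun h => absurd h hc.not_gt, fun h => absurd h hc.ne⟩
    obtain ⟨e, t, l, -, hl, hp, h⟩ := dirSlope_spec p d
    refine (h _ _).2 (((h _ _).1 (hσ d)).min_of_lt (hl.trans nhdsWithin_le_nhds)
      (hasInSlope_const c t l) ?_)
    rwa [hp]
  · refine ⟨∑ d, max (σ d) 0, (hasOrd_iff _ _ _).2 ⟨_, fun d => ?_, rfl⟩,
      fun h => absurd hc h.ne, fun h => absurd hc h.ne', fun _ => ⟨?_, ?_, fun h0 ha d => ?_⟩⟩
    · obtain ⟨e, t, l, -, hl, hp, h⟩ := dirSlope_spec p d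
      refine (h _ _).2 (((h _ _).1 (hσ d)).min_of_eq (hasInSlope_const c t l) ?_)
      rwa [Function.comp_apply, hp]
    · exact Finset.sum_nonneg fun d _ => le_max_right _ _
    · exact Finset.sum_le_sum fun d _ => le_max_left _ _
    · have h1 : ∀ d, σ d ≤ 0 := fun d => by
        have := (Finset.sum_eq_zero_iff_of_nonneg fun d _ => le_max_right (σ d) 0).1 h0 d
          (Finset.mem_univ d)
        exact (le_max_left _ _).trans this.le
      have h2 := (Finset.sum_eq_zero_iff_of_nonpos fun d _ => h1 d).1 ha d (Finset.mem_univ d)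
      exact h2 ▸ hσ d
  · refine ⟨0, (hasOrd_iff _ _ _).2 ⟨fun _ => 0, fun d => ?_, by simp⟩,
      fun h => absurd h hc.not_gt, fun _ => rfl, fun h => absurd h hc.ne'⟩
    obtain ⟨e, t, l, -, hl, hp, h⟩ := dirSlope_spec p d
    refine (h _ _).2 ?_
    have := (hasInSlope_const c t l).min_of_lt (hl.trans nhdsWithin_le_nhds)
      ((h _ _).1 (hσ d)) (by rwa [Function.comp_apply, hp])
    exact this.congr (Eventually.of_forall fun s => min_comm _ _) (min_comm _ _)

/-- The tropical sum of two sections: if `D₂ = D₁ + div φ`, then `D₁ + div (min φ c)` is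
effective, and it dominates both `D₁` and `D₂` where `φ = c`. -/
theorem exists_tropical_sum {D₁ D₂ : Γ.Divisor} (h₁ : Effective D₁) (h₂ : Effective D₂)
    {φ : Γ.Point → ℝ} (hφ : ∀ p, HasOrd φ p (D₂ p - D₁ p)) (c : ℝ) :
    ∃ D : Γ.Divisor, LinEquiv D D₁ ∧ Effective D ∧ ∀ x, φ x = c →
      D₁ x ≤ D x ∧ D₂ x ≤ D x ∧ (D x = 0 → ∀ d, DirSlope φ x d 0) := by
  choose m hm hlt hgt heq using fun p => (hφ p).min_const c
  obtain ⟨F, hF⟩ := exists_divisor fun p => ⟨_, hm p⟩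
  have hFm : ∀ p, F p = m p := fun p => (hF p).unique (hm p)
  refine ⟨D₁ + F, ⟨_, fun p => by simpa using hF p⟩, fun p => ?_, fun x hx => ?_⟩
  · have h1 := h₁ p
    have h2 := h₂ p
    rw [Finsupp.add_apply, hFm]
    rcases lt_trichotomy (φ p) c with h | h | h
    · have := hlt p h; omega
    · have := heq p h; omega
    · have := hgt p h; omega
  · obtain ⟨h3, h4, h5⟩ := heq x hx
    have h1 := h₁ x
    have h2 := h₂ x
    rw [Finsupp.add_apply, hFm]
    exact ⟨by omega, by omega, fun h0 => h5 (by omega) (by omega)⟩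

/-- The witness is the supremum of the points of `[0, t]` where `f ≠ c`, or `0` if there are none.
Continuity from the right gives `f = c` there, and a vanishing slope on its left would contradict
the choice as supremum. -/
theorem exists_left_end {f : ℝ → ℝ} {t c : ℝ} (ht : 0 ≤ t)
    (hf : ∀ x, ∃ m, HasInSlope f x (𝓝[>] x) m) (hc : f t = c) :
    ∃ s, 0 ≤ s ∧ s ≤ t ∧ f s = c ∧ (s = 0 ∨ ¬ HasInSlope f s (𝓝[<] s) 0) := by
  by_cases hall : ∀ x ∈ Set.Icc 0 t, f x = c
  · exact ⟨0, le_rfl, ht, hall 0 ⟨le_rfl, ht⟩, Or.inl rfl⟩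
  push Not at hall
  obtain ⟨x, hx, hxc⟩ := hall
  set S := {x | x ∈ Set.Icc 0 t ∧ f x ≠ c} with hS
  have hbdd : BddAbove S := ⟨t, fun y hy => hy.1.2⟩
  have hxs : x ≤ sSup S := le_csSup hbdd ⟨hx, hxc⟩
  have hst : sSup S ≤ t := csSup_le ⟨x, hx, hxc⟩ fun y hy => hy.1.2
  have hgt : ∀ y, sSup S < y → y ≤ t → f y = c := by
    intro y hy hyt
    by_contra hne
    exact (le_csSup hbdd ⟨⟨(hx.1.trans hxs).trans hy.le, hyt⟩, hne⟩).not_gt hy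
  have hs : f (sSup S) = c := by
    rcases hst.eq_or_lt with h | h
    · rw [h, hc]
    · obtain ⟨m, hm⟩ := hf (sSup S)
      refine tendsto_nhds_unique (hm.tendsto nhdsWithin_le_nhds)
        (tendsto_const_nhds.congr' ?_)
      filter_upwards [Ioo_mem_nhdsGT h] with y hy
      exact (hgt y hy.1 hy.2.le).symm
  refine ⟨sSup S, hx.1.trans hxs, hst, hs, Or.inr fun h0 => ?_⟩
  obtain ⟨a, ha, hsub⟩ := (mem_nhdsLT_iff_exists_Ioo_subset).1 h0
  refine absurd ha (not_lt.2 (show sSup S ≤ a from csSup_le ⟨x, hx, hxc⟩ fun y hy => ?_))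
  by_contra hya
  have hys : y < sSup S := lt_of_le_of_ne (le_csSup hbdd hy) fun h => hy.2 (h ▸ hs)
  have h2 : f (sSup S) = f y + ((0 : ℤ) : ℝ) * |sSup S - y| := 
    hsub (show y ∈ Set.Ioo a (sSup S) from ⟨not_le.1 hya, hys⟩)
  rw [Int.cast_zero, zero_mul, add_zero, hs] at h2
  exact hy.2 h2.symm

/-! ### Functions defined edge by edge. -/

/-- The function on the graph given by its values at the vertices and on the edges. -/
def edgewise (h : Γ.V → ℝ) (F : Γ.E → ℝ → ℝ) : Γ.Point → ℝ
  | .vertex v => h v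
  | .inner e t _ => F e t

theorem edgewise_edgePoint {h : Γ.V → ℝ} {F : Γ.E → ℝ → ℝ} {e : Γ.E}
    (h0 : F e 0 = h (Γ.src e)) (h1 : F e (Γ.len e) = h (Γ.tgt e)) {t : ℝ}
    (ht : t ∈ Set.Icc 0 (Γ.len e)) : edgewise h F (Γ.edgePoint e t) = F e t := by
  rcases ht.1.eq_or_lt with rfl | h2
  · rw [edgePoint_zero, edgewise, h0]
  rcases ht.2.eq_or_lt with rfl | h3
  · rw [edgePoint_len, edgewise, h1]
  · rw [edgePoint_inner e ⟨h2, h3⟩]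
    rfl

theorem edgewise_slope {h : Γ.V → ℝ} {F : Γ.E → ℝ → ℝ} {e : Γ.E}
    (h0 : F e 0 = h (Γ.src e)) (h1 : F e (Γ.len e) = h (Γ.tgt e)) {t : ℝ}
    (ht : t ∈ Set.Icc 0 (Γ.len e)) {l : Filter ℝ} (hl : ∀ᶠ s in l, s ∈ Set.Icc 0 (Γ.len e))
    {m : ℤ} (hm : HasInSlope (F e) t l m) :
    HasInSlope (edgewise h F ∘ Γ.edgePoint e) t l m :=
  hm.congr (hl.mono fun _ hs => (edgewise_edgePoint h0 h1 hs).symm)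
    (edgewise_edgePoint h0 h1 ht).symm

theorem hasOrd_edgewise_inner {h : Γ.V → ℝ} {F : Γ.E → ℝ → ℝ} {e : Γ.E}
    (h0 : F e 0 = h (Γ.src e)) (h1 : F e (Γ.len e) = h (Γ.tgt e)) {t : ℝ}
    (ht : t ∈ Set.Ioo 0 (Γ.len e)) {a b : ℤ} (ha : HasInSlope (F e) t (𝓝[<] t) a)
    (hb : HasInSlope (F e) t (𝓝[>] t) b) : HasOrd (edgewise h F) (.inner e t ht) (a + b) :=
  ⟨a, b, edgewise_slope h0 h1 (Set.Ioo_subset_Icc_self ht)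
      (nhdsWithin_le_nhds (Icc_mem_nhds ht.1 ht.2)) ha,
    edgewise_slope h0 h1 (Set.Ioo_subset_Icc_self ht)
      (nhdsWithin_le_nhds (Icc_mem_nhds ht.1 ht.2)) hb, rfl⟩

open Classical in
theorem hasOrd_edgewise_vertex {h : Γ.V → ℝ} {F : Γ.E → ℝ → ℝ}
    (h0 : ∀ e, F e 0 = h (Γ.src e)) (h1 : ∀ e, F e (Γ.len e) = h (Γ.tgt e)) (v : Γ.V)
    {a b : Γ.E → ℤ} (ha : ∀ e, HasInSlope (F e) 0 (𝓝[>] 0) (a e))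
    (hb : ∀ e, HasInSlope (F e) (Γ.len e) (𝓝[<] (Γ.len e)) (b e)) :
    HasOrd (edgewise h F) (.vertex v)
      (∑ e ∈ Finset.univ.filter (fun e => Γ.src e = v), a e
        + ∑ e ∈ Finset.univ.filter (fun e => Γ.tgt e = v), b e) :=
  ⟨a, b, fun e _ => edgewise_slope (h0 e) (h1 e) ⟨le_rfl, (Γ.len_pos e).le⟩
      (mem_of_superset (Ioo_mem_nhdsGT (Γ.len_pos e)) Set.Ioo_subset_Icc_self) (ha e),
    fun e _ => edgewise_slope (h0 e) (h1 e) ⟨(Γ.len_pos e).le, le_rfl⟩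
      (mem_of_superset (Ioo_mem_nhdsLT (Γ.len_pos e)) Set.Ioo_subset_Icc_self) (hb e), rfl⟩

/-! ### Lower bounds for orders, and trapezoid functions. -/

theorem hasInSlope_left_sub (c t : ℝ) : HasInSlope (fun s => s - c) t (𝓝[<] t) 1 := by
  simpa [sub_eq_add_neg] using hasInSlope_left_affine 1 (-c) t

theorem hasInSlope_right_sub (c t : ℝ) : HasInSlope (fun s => s - c) t (𝓝[>] t) (-1) := by
  simpa [sub_eq_add_neg] using hasInSlope_right_affine 1 (-c) t

theorem hasInSlope_left_sub' (c t : ℝ) : HasInSlope (fun s => c - s) t (𝓝[<] t) (-1) := by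
  simpa [sub_eq_add_neg, add_comm] using hasInSlope_left_affine (-1) c t

theorem hasInSlope_right_sub' (c t : ℝ) : HasInSlope (fun s => c - s) t (𝓝[>] t) 1 := by
  simpa [sub_eq_add_neg, add_comm] using hasInSlope_right_affine (-1) c t

/-- `f` is piecewise linear with integer slopes at `t`, where the incoming slopes sum up to at
least `k`. -/
def OrdGE (f : ℝ → ℝ) (t : ℝ) (k : ℤ) : Prop :=
  ∃ a b, HasInSlope f t (𝓝[<] t) a ∧ HasInSlope f t (𝓝[>] t) b ∧ k ≤ a + b

/-- Where the functions tie, each incoming slope of the minimum is the larger of the two, so a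
common lower bound survives. Minima of affine functions are thereby shown to have nonnegative order.
-/
theorem OrdGE.min {f g : ℝ → ℝ} {t : ℝ} {k : ℤ} (hf : OrdGE f t k) (hg : OrdGE g t k) :
    OrdGE (fun s => min (f s) (g s)) t k := by
  obtain ⟨a, b, ha, hb, hab⟩ := hf
  obtain ⟨a', b', ha', hb', hab'⟩ := hg
  rcases lt_trichotomy (f t) (g t) with h | h | h
  · exact ⟨a, b, ha.min_of_lt nhdsWithin_le_nhds ha' h, hb.min_of_lt nhdsWithin_le_nhds hb' h, hab⟩
  · exact ⟨_, _, ha.min_of_eq ha' h, hb.min_of_eq hb' h,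
      hab.trans (add_le_add (le_max_left _ _) (le_max_left _ _))⟩
  · refine ⟨a', b', ?_, ?_, hab'⟩
    · simpa only [min_comm] using ha'.min_of_lt nhdsWithin_le_nhds ha h
    · simpa only [min_comm] using hb'.min_of_lt nhdsWithin_le_nhds hb h

theorem OrdGE.congr {f g : ℝ → ℝ} {t : ℝ} {k : ℤ} (hf : OrdGE f t k) (h : f =ᶠ[𝓝 t] g) :
    OrdGE g t k := by
  obtain ⟨a, b, ha, hb, hab⟩ := hf
  exact ⟨a, b, ha.congr (h.filter_mono nhdsWithin_le_nhds) h.self_of_nhds,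
    hb.congr (h.filter_mono nhdsWithin_le_nhds) h.self_of_nhds, hab⟩

theorem ordGE_sub (c t : ℝ) : OrdGE (fun s => s - c) t 0 :=
  ⟨1, -1, hasInSlope_left_sub c t, hasInSlope_right_sub c t, by norm_num⟩

theorem ordGE_sub' (c t : ℝ) : OrdGE (fun s => c - s) t 0 :=
  ⟨-1, 1, hasInSlope_left_sub' c t, hasInSlope_right_sub' c t, by norm_num⟩

theorem ordGE_const (c t : ℝ) : OrdGE (fun _ => c) t 0 :=
  ⟨0, 0, hasInSlope_const c t _, hasInSlope_const c t _, by norm_num⟩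

/-- A trapezoid over `[s, t]` of height `δ`. -/
noncomputable def trapezoid (s t δ x : ℝ) : ℝ := max 0 (min (min (x - s) (t - x)) δ)

theorem trapezoid_of_le {s t δ x : ℝ} (h : x ≤ s) : trapezoid s t δ x = 0 :=
  max_eq_left ((min_le_left _ _).trans ((min_le_left _ _).trans (sub_nonpos.2 h)))

theorem trapezoid_of_ge {s t δ x : ℝ} (h : t ≤ x) : trapezoid s t δ x = 0 :=
  max_eq_left ((min_le_left _ _).trans ((min_le_right _ _).trans (sub_nonpos.2 h)))

theorem trapezoid_eq {s t δ x : ℝ} (hs : s ≤ x) (ht : x ≤ t) (hδ : 0 ≤ δ) :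
    trapezoid s t δ x = min (min (x - s) (t - x)) δ :=
  max_eq_right (le_min (le_min (sub_nonneg.2 hs) (sub_nonneg.2 ht)) hδ)

theorem trapezoid_right_start {s t δ : ℝ} (hst : s < t) (hδ : 0 < δ) :
    HasInSlope (trapezoid s t δ) s (𝓝[>] s) (-1) := by
  refine (hasInSlope_right_sub s s).congr ?_ (by simp [trapezoid_of_le])
  have h1 : ∀ᶠ x in 𝓝 s, x - s < t - x :=
    (Continuous.tendsto (by fun_prop) s).eventually_lt (Continuous.tendsto (by fun_prop) s)
      (by simpa using hst)
  have h2 : ∀ᶠ x in 𝓝 s, x - s < δ :=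
    (Continuous.tendsto (by fun_prop) s).eventually_lt tendsto_const_nhds (by simpa using hδ)
  filter_upwards [nhdsWithin_le_nhds h1, nhdsWithin_le_nhds h2, self_mem_nhdsWithin]
    with x h3 h4 (h5 : s < x)
  rw [trapezoid_eq h5.le (by linarith) hδ.le, min_eq_left h3.le, min_eq_left h4.le]

theorem trapezoid_left_end {s t δ : ℝ} (hst : s < t) (hδ : 0 < δ) :
    HasInSlope (trapezoid s t δ) t (𝓝[<] t) (-1) := by
  refine (hasInSlope_left_sub' t t).congr ?_ (by simp [trapezoid_of_ge])
  have h1 : ∀ᶠ x in 𝓝 t, t - x < x - s :=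
    (Continuous.tendsto (by fun_prop) t).eventually_lt (Continuous.tendsto (by fun_prop) t)
      (by simpa using hst)
  have h2 : ∀ᶠ x in 𝓝 t, t - x < δ :=
    (Continuous.tendsto (by fun_prop) t).eventually_lt tendsto_const_nhds (by simpa using hδ)
  filter_upwards [nhdsWithin_le_nhds h1, nhdsWithin_le_nhds h2, self_mem_nhdsWithin]
    with x h3 h4 (h5 : x < t)
  rw [trapezoid_eq (by linarith) h5.le hδ.le, min_eq_right h3.le, min_eq_left h4.le]

theorem trapezoid_left_start {s t δ x : ℝ} (h : x ≤ s) :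
    HasInSlope (trapezoid s t δ) x (𝓝[<] x) 0 := by
  refine (hasInSlope_const 0 x _).congr ?_ (trapezoid_of_le h).symm
  filter_upwards [self_mem_nhdsWithin] with y (hy : y < x)
  exact (trapezoid_of_le (hy.le.trans h)).symm

theorem trapezoid_right_end {s t δ x : ℝ} (h : t ≤ x) :
    HasInSlope (trapezoid s t δ) x (𝓝[>] x) 0 := by
  refine (hasInSlope_const 0 x _).congr ?_ (trapezoid_of_ge h).symm
  filter_upwards [self_mem_nhdsWithin] with y (hy : x < y)
  exact (trapezoid_of_ge (h.trans hy.le)).symm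

theorem trapezoid_eventuallyEq {s t δ x : ℝ} (hs : s < x) (ht : x < t) (hδ : 0 < δ) :
    (fun x => min (min (x - s) (t - x)) δ) =ᶠ[𝓝 x] trapezoid s t δ := by
  filter_upwards [Ioo_mem_nhds hs ht] with y hy
  exact (trapezoid_eq hy.1.le hy.2.le hδ.le).symm

theorem ordGE_trapezoid {s t δ x : ℝ} (hst : s < t) (hδ : 0 < δ) :
    OrdGE (trapezoid s t δ) x (if x = s ∨ x = t then -1 else 0) := by
  rcases lt_trichotomy x s with h | rfl | h
  · rw [if_neg (by rintro (h' | h') <;> linarith)]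
    refine (ordGE_const 0 x).congr ?_
    filter_upwards [Iio_mem_nhds h] with y hy
    exact (trapezoid_of_le (le_of_lt hy)).symm
  · rw [if_pos (Or.inl rfl)]
    exact ⟨0, -1, trapezoid_left_start le_rfl, trapezoid_right_start hst hδ, by norm_num⟩
  rcases lt_trichotomy x t with h' | rfl | h'
  · rw [if_neg (by rintro (h' | h') <;> linarith)]
    exact (((ordGE_sub s x).min (ordGE_sub' t x)).min (ordGE_const δ x)).congr
      (trapezoid_eventuallyEq h h' hδ)
  · rw [if_pos (Or.inr rfl)]
    exact ⟨-1, 0, trapezoid_left_end hst hδ, trapezoid_right_end le_rfl, by norm_num⟩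
  · rw [if_neg (by rintro (h' | h') <;> linarith)]
    refine (ordGE_const 0 x).congr ?_
    filter_upwards [Ioi_mem_nhds h'] with y hy
    exact (trapezoid_of_ge (le_of_lt hy)).symm

/-- With height `min (x - s) (t - x)` the plateau begins or ends exactly at `x`, which is where a
moved chip lands; if the two distances agree, the plateau is the single point `x`. -/
theorem ordGE_trapezoid_corner {s t x : ℝ} (hs : s < x) (ht : x < t) :
    OrdGE (trapezoid s t (min (x - s) (t - x))) x 1 := by
  refine OrdGE.congr ?_ (trapezoid_eventuallyEq hs ht (lt_min (sub_pos.2 hs) (sub_pos.2 ht)))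
  rcases lt_trichotomy (x - s) (t - x) with h | h | h
  · rw [min_eq_left h.le]
    exact ⟨_, _, ((hasInSlope_left_sub s x).min_of_lt nhdsWithin_le_nhds
        (hasInSlope_left_sub' t x) h).min_of_eq (hasInSlope_const _ _ _) (min_eq_left h.le),
      ((hasInSlope_right_sub s x).min_of_lt nhdsWithin_le_nhds
        (hasInSlope_right_sub' t x) h).min_of_eq (hasInSlope_const _ _ _) (min_eq_left h.le),
      by norm_num⟩
  · rw [min_eq_left h.le]
    exact ⟨_, _, ((hasInSlope_left_sub s x).min_of_eq
        (hasInSlope_left_sub' t x) h).min_of_eq (hasInSlope_const _ _ _) (min_eq_left h.le),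
      ((hasInSlope_right_sub s x).min_of_eq
        (hasInSlope_right_sub' t x) h).min_of_eq (hasInSlope_const _ _ _) (min_eq_left h.le),
      by norm_num⟩
  · rw [min_eq_right h.le]
    simp only [min_comm (_ - s)]
    exact ⟨_, _, ((hasInSlope_left_sub' t x).min_of_lt nhdsWithin_le_nhds
        (hasInSlope_left_sub s x) h).min_of_eq (hasInSlope_const _ _ _) (min_eq_left h.le),
      ((hasInSlope_right_sub' t x).min_of_lt nhdsWithin_le_nhds
        (hasInSlope_right_sub s x) h).min_of_eq (hasInSlope_const _ _ _) (min_eq_left h.le),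
      by norm_num⟩

/-! ### From the endpoints of an edge to its interior points. -/

/-- Two chips on an edge can be moved towards each other by the same amount, until one of them
reaches a given point between them. -/
theorem exists_move_together {D : Γ.Divisor} (hD : Effective D) {e : Γ.E}
    (hloop : Γ.src e ≠ Γ.tgt e) {s x t : ℝ} (hs : 0 ≤ s) (hsx : s < x) (hxt : x < t)
    (ht : t ≤ Γ.len e) (h1 : 1 ≤ D (Γ.edgePoint e s)) (h2 : 1 ≤ D (Γ.edgePoint e t)) :
    ∃ D', LinEquiv D' D ∧ Effective D' ∧ 1 ≤ D' (Γ.edgePoint e x) := by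
  classical
  have hδ : 0 < min (x - s) (t - x) := lt_min (sub_pos.2 hsx) (sub_pos.2 hxt)
  have hst := hsx.trans hxt
  have hx : x ∈ Set.Ioo 0 (Γ.len e) := ⟨hs.trans_lt hsx, hxt.trans_le ht⟩
  set F : Γ.E → ℝ → ℝ := fun e' => if e' = e then trapezoid s t (min (x - s) (t - x))
    else fun _ => 0 with hF
  have hFe : F e = trapezoid s t (min (x - s) (t - x)) := if_pos rfl
  have hFne : ∀ e', e' ≠ e → F e' = fun _ => 0 := fun e' h => if_neg h
  have hF0 : ∀ e', F e' 0 = 0 := by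
    intro e'
    by_cases h : e' = e
    · rw [h, hFe, trapezoid_of_le hs]
    · rw [hFne e' h]
  have hF1 : ∀ e', F e' (Γ.len e') = 0 := by
    intro e'
    by_cases h : e' = e
    · rw [h, hFe, trapezoid_of_ge ht]
    · rw [hFne e' h]
  -- The trapezoid has order at least `-1` at its two feet, where `D` has a chip each, and
  -- nonnegative order elsewhere. As the edge is not a loop, the feet are different points of the
  -- graph even if both are vertices.
  have key : ∀ p, ∃ m, HasOrd (edgewise (fun _ => 0) F) p m ∧ 0 ≤ D p + m ∧
      (p = Γ.edgePoint e x → 1 ≤ m) := by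
    intro p
    have hDp := hD p
    rcases p with v | ⟨e', y, hy⟩
    · have ha : ∀ e', HasInSlope (F e') 0 (𝓝[>] 0)
          (if e' = e then (if s = 0 then -1 else 0) else 0) := by
        intro e'
        by_cases h : e' = e
        · rw [if_pos h, h, hFe]
          by_cases h0 : s = 0
          · rw [if_pos h0]
            have := trapezoid_right_start hst hδ
            rwa [h0] at this ⊢
          · rw [if_neg h0]
            refine (hasInSlope_const 0 0 _).congr ?_ (trapezoid_of_le hs).symm
            filter_upwards [Ioo_mem_nhdsGT (lt_of_le_of_ne hs (Ne.symm h0))] with y hy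
            exact (trapezoid_of_le hy.2.le).symm
        · rw [if_neg h, hFne e' h]
          exact hasInSlope_const 0 0 _
      have hb : ∀ e', HasInSlope (F e') (Γ.len e') (𝓝[<] (Γ.len e'))
          (if e' = e then (if t = Γ.len e then -1 else 0) else 0) := by
        intro e'
        by_cases h : e' = e
        · rw [if_pos h, h, hFe]
          by_cases h0 : t = Γ.len e
          · rw [if_pos h0]
            have := trapezoid_left_end hst hδ
            rwa [h0] at this ⊢
          · rw [if_neg h0]
            refine (hasInSlope_const 0 _ _).congr ?_ (trapezoid_of_ge ht).symm
            filter_upwards [Ioo_mem_nhdsLT (lt_of_le_of_ne ht h0)] with y hy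
            exact (trapezoid_of_ge hy.1.le).symm
        · rw [if_neg h, hFne e' h]
          exact hasInSlope_const 0 _ _
      refine ⟨_, hasOrd_edgewise_vertex hF0 hF1 v ha hb, ?_, fun h => ?_⟩
      · rw [Finset.sum_ite_eq', Finset.sum_ite_eq']
        simp only [Finset.mem_filter, Finset.mem_univ, true_and]
        by_cases hsrc : Γ.src e = v
        · have htgt : Γ.tgt e ≠ v := fun h => hloop (hsrc.trans h.symm)
          rw [if_pos hsrc, if_neg htgt]
          split_ifs with h0
          · rw [h0, edgePoint_zero, hsrc] at h1
            omega
          · omega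
        · rw [if_neg hsrc]
          split_ifs with htgt h0
          · rw [h0, edgePoint_len, htgt] at h2
            omega
          · omega
          · omega
      · rw [edgePoint_inner e hx] at h
        cases h
    · by_cases h : e' = e
      · subst h
        by_cases hyx : y = x
        · subst hyx
          obtain ⟨a, b, ha, hb, hab⟩ := ordGE_trapezoid_corner hsx hxt
          rw [← hFe] at ha hb
          exact ⟨_, hasOrd_edgewise_inner (hF0 e') (hF1 e') hy ha hb, by omega, fun _ => hab⟩
        · obtain ⟨a, b, ha, hb, hab⟩ := ordGE_trapezoid (x := y) hst hδ
          rw [← hFe] at ha hb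
          refine ⟨_, hasOrd_edgewise_inner (hF0 e') (hF1 e') hy ha hb, ?_, fun h => ?_⟩
          · split_ifs at hab with h
            · rcases h with rfl | rfl
              · rw [edgePoint_inner e' hy] at h1
                omega
              · rw [edgePoint_inner e' hy] at h2
                omega
            · omega
          · rw [edgePoint_inner e' hx] at h
            cases h
            exact absurd rfl hyx
      · refine ⟨_, hasOrd_edgewise_inner (a := 0) (b := 0) (hF0 e') (hF1 e') hy ?_ ?_, by omega,
          fun h' => ?_⟩
        · rw [hFne e' h]
          exact hasInSlope_const 0 _ _
        · rw [hFne e' h]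
          exact hasInSlope_const 0 _ _
        · rw [edgePoint_inner e hx] at h'
          cases h'
          exact absurd rfl h
  choose m hm hge h1x using key
  obtain ⟨G, hG⟩ := exists_divisor fun p => ⟨_, hm p⟩
  have hGm : ∀ p, G p = m p := fun p => (hG p).unique (hm p)
  refine ⟨D + G, ⟨_, fun p => by simpa using hG p⟩, fun p => ?_, ?_⟩
  · rw [Finsupp.add_apply, hGm]
    exact hge p
  · rw [Finsupp.add_apply, hGm]
    have := h1x _ rfl
    have := hD (Γ.edgePoint e x)
    omega

/-- On a metric graph presented without loops, a divisor class which can reach all vertices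
can reach all points. -/
theorem exists_ge_one_of_vertices (hloop : ∀ e, Γ.src e ≠ Γ.tgt e) {D : Γ.Divisor}
    (h : ∀ v : Γ.V, ∃ D', LinEquiv D' D ∧ Effective D' ∧ 1 ≤ D' (.vertex v)) (p : Γ.Point) :
    ∃ D', LinEquiv D' D ∧ Effective D' ∧ 1 ≤ D' p := by
  rcases p with v | ⟨e, x, hx⟩
  · exact h v
  obtain ⟨D₁, hD₁, hE₁, h₁⟩ := h (Γ.src e)
  obtain ⟨D₂, hD₂, hE₂, h₂⟩ := h (Γ.tgt e)
  obtain ⟨φ, hφ⟩ : LinEquiv D₂ D₁ := hD₂.trans hD₁.symm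
  set f := φ ∘ Γ.edgePoint e with hf
  -- Truncating at the level `φ x` makes `x` lie on the level set; `s` and `Γ.len e - t` are ends of
  -- it on the two sides of `x`, the second found on the reversed edge.
  obtain ⟨D', hD', hE', hDc⟩ := exists_tropical_sum hE₁ hE₂ (fun p => by simpa using hφ p) (f x)
  obtain ⟨s, hs0, hsx, hs, hs'⟩ := exists_left_end (f := f) hx.1.le
    (exists_slope_right (fun p => ⟨_, hφ p⟩) e) rfl
  obtain ⟨t, ht0, htx, ht, ht'⟩ := exists_left_end (f := fun y => f (Γ.len e - y))
    (t := Γ.len e - x) (c := f x) (sub_nonneg.2 hx.2.le) (fun y => by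
      obtain ⟨m, hm⟩ := exists_slope_left (fun p => ⟨_, hφ p⟩) e (Γ.len e - y)
      have := hm.reflect_left (c := Γ.len e)
      rw [sub_sub_cancel] at this
      exact ⟨m, this⟩) (by rw [sub_sub_cancel])
  -- At the source vertex the chip comes from `D₁`. At an interior point a missing chip would force
  -- all slopes to vanish, against the choice of `s`.
  have hchip_s : 1 ≤ D' (Γ.edgePoint e s) := by
    obtain ⟨h3, h4, h5⟩ := hDc (Γ.edgePoint e s) hs
    rcases hs0.eq_or_lt with rfl | hs0
    · rw [edgePoint_zero] at *
      omega
    by_contra hlt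
    have h0 : D' (Γ.edgePoint e s) = 0 := le_antisymm (by omega) (hE' _)
    have h6 := h5 h0
    rw [edgePoint_inner e ⟨hs0, hsx.trans_lt hx.2⟩] at h6
    exact hs'.elim hs0.ne' fun h => h (h6 true)
  have hchip_t : 1 ≤ D' (Γ.edgePoint e (Γ.len e - t)) := by
    obtain ⟨h3, h4, h5⟩ := hDc (Γ.edgePoint e (Γ.len e - t)) ht
    rcases ht0.eq_or_lt with rfl | ht0
    · rw [sub_zero, edgePoint_len] at *
      omega
    by_contra hlt
    have h0 : D' (Γ.edgePoint e (Γ.len e - t)) = 0 := le_antisymm (by omega) (hE' _)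
    have h6 := h5 h0
    rw [edgePoint_inner e ⟨by linarith [hx.1], by linarith⟩] at h6
    refine ht'.elim ht0.ne' fun h => h ?_
    have h7 : HasInSlope f (Γ.len e - t) (𝓝[>] (Γ.len e - t)) 0 := h6 false
    exact HasInSlope.reflect_right (c := Γ.len e) (by simpa only [sub_sub_cancel] using h7)
  rw [← edgePoint_inner e hx]
  rcases hsx.eq_or_lt with rfl | hsx
  · exact ⟨D', hD'.trans hD₁, hE', hchip_s⟩
  rcases htx.eq_or_lt with rfl | htx
  · rw [sub_sub_cancel] at hchip_t
    exact ⟨D', hD'.trans hD₁, hE', hchip_t⟩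
  obtain ⟨D'', h1, h2, h3⟩ := exists_move_together hE' (hloop e) hs0 hsx
    (t := Γ.len e - t) (by linarith) (by linarith) hchip_s hchip_t
  exact ⟨D'', h1.trans (hD'.trans hD₁), h2, h3⟩

/-! ### From single chips to ranks. -/

theorem effective_sub_single_iff {D : Γ.Divisor} (p : Γ.Point) :
    Effective (D - Finsupp.single p 1) ↔ Effective D ∧ 1 ≤ D p := by
  classical
  constructor
  · intro h
    have h1 : ∀ q, 0 ≤ D q - (Finsupp.single p (1 : ℤ)) q := h
    refine ⟨fun q => ?_, by simpa using h1 p⟩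
    have := h1 q
    rw [Finsupp.single_apply] at this
    split_ifs at this <;> omega
  · rintro ⟨h1, h2⟩ q
    rw [Finsupp.sub_apply, Finsupp.single_apply]
    split_ifs with h
    · subst h; omega
    · have := h1 q; omega

theorem degree_add (D E : Γ.Divisor) : degree (D + E) = degree D + degree E :=
  Finsupp.sum_add_index' (fun _ => rfl) fun _ _ _ => rfl

theorem degree_single (p : Γ.Point) (n : ℤ) : degree (Finsupp.single p n) = n :=
  Finsupp.sum_single_index rfl

theorem Effective.add {D E : Γ.Divisor} (hD : Effective D) (hE : Effective E) :
    Effective (D + E) := fun p => add_nonneg (hD p) (hE p)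

theorem effective_single (p : Γ.Point) : Effective (Finsupp.single p 1) := by
  classical
  intro q
  rw [Finsupp.single_apply]
  split_ifs <;> norm_num

theorem Effective.eq_zero_of_degree {D : Γ.Divisor} (hD : Effective D) (h : degree D = 0) :
    D = 0 := by
  ext p
  by_contra hp
  exact hp ((Finset.sum_eq_zero_iff_of_nonneg fun q _ => hD q).1 h p
    (Finsupp.mem_support_iff.2 hp))

/-- An effective divisor of degree `r + 1` is a point plus an effective divisor of degree `r`. -/
theorem Effective.exists_eq_add {D : Γ.Divisor} (hD : Effective D) {r : ℕ}
    (h : degree D = ((r + 1 : ℕ) : ℤ)) : ∃ (p : Γ.Point) (E : Γ.Divisor),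
      Effective E ∧ degree E = (r : ℤ) ∧ D = E + Finsupp.single p 1 ∧ p ∈ D.support := by
  have hne : D.support.Nonempty := by
    by_contra hemp
    rw [Finset.not_nonempty_iff_eq_empty, Finsupp.support_eq_empty] at hemp
    rw [hemp] at h
    simp [degree] at h
    omega
  obtain ⟨p, hp⟩ := hne
  have h1 : 1 ≤ D p := by
    have := hD p
    have := Finsupp.mem_support_iff.1 hp
    omega
  have h2 : D = D - Finsupp.single p 1 + Finsupp.single p 1 := by abel
  refine ⟨p, _, (effective_sub_single_iff p).2 ⟨hD, h1⟩, ?_, h2, hp⟩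
  rw [h2, degree_add, degree_single] at h
  push_cast at h
  omega

/-- `D` can reach every effective divisor of degree `r` supported in `A`. -/
def Reaches (A : Set Γ.Point) (D : Γ.Divisor) (r : ℕ) : Prop :=
  ∀ E : Γ.Divisor, Effective E → degree E = (r : ℤ) → (E.support : Set Γ.Point) ⊆ A →
    ∃ D' : Γ.Divisor, LinEquiv D D' ∧ Effective (D' - E)

/-- To reach `F + p`, trade `p` for points of `A`: for each `a ∈ A` the divisor `D - a` reaches `F`
by induction, so the class of `D - F` reaches `a`. The hypothesis then lets `D - F` reach `p`. -/
theorem Reaches.univ {A : Set Γ.Point} (hA : ∀ D : Γ.Divisor,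
      (∀ a ∈ A, ∃ D', LinEquiv D' D ∧ Effective D' ∧ 1 ≤ D' a) →
      ∀ p, ∃ D', LinEquiv D' D ∧ Effective D' ∧ 1 ≤ D' p) {r : ℕ} {D : Γ.Divisor}
    (h : Reaches A D r) : Reaches Set.univ D r := by
  classical
  induction r generalizing D with
  | zero =>
    intro E hE hdeg _
    exact h E hE hdeg (by simp [hE.eq_zero_of_degree (by simpa using hdeg)])
  | succ r ih =>
    intro E hE hdeg _
    obtain ⟨p, F, hF, hFdeg, rfl, -⟩ := hE.exists_eq_add hdeg
    have h1 : ∀ a ∈ A, ∃ D', LinEquiv D' (D - F) ∧ Effective D' ∧ 1 ≤ D' a := by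
      intro a ha
      have h2 : Reaches A (D - Finsupp.single a 1) r := by
        intro G hG hGdeg hGA
        obtain ⟨D', hD', hE'⟩ := h (G + Finsupp.single a 1) (hG.add (effective_single a))
          (by rw [degree_add, degree_single, hGdeg]; push_cast; rfl) (by
            refine (Finset.coe_subset.2 Finsupp.support_add).trans ?_
            rw [Finset.coe_union]
            refine Set.union_subset hGA ?_
            refine (Finset.coe_subset.2 Finsupp.support_single_subset).trans ?_
            simpa using ha)
        refine ⟨D' - Finsupp.single a 1, hD'.sub_right _, ?_⟩
        rwa [sub_sub, add_comm]
      obtain ⟨D', hD', hE'⟩ := ih h2 F hF hFdeg (Set.subset_univ _)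
      refine ⟨D' - F + Finsupp.single a 1, ?_, hE'.add (effective_single a), ?_⟩
      · have := (hD'.add_right (Finsupp.single a 1)).sub_right F
        rw [sub_add_cancel] at this
        rw [sub_add_eq_add_sub]
        exact this.symm
      · have := hE' a
        rw [Finsupp.add_apply, Finsupp.single_eq_same]
        omega
    obtain ⟨D', hD', hE', hp⟩ := hA _ h1 p
    refine ⟨D' + F, ?_, ?_⟩
    · have := hD'.add_right F
      rw [sub_add_cancel] at this
      exact this.symm
    · rw [show D' + F - (F + Finsupp.single p 1) = D' - Finsupp.single p 1 by abel]
      exact (effective_sub_single_iff p).2 ⟨hE', hp⟩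

theorem isRankDetermining_of_forall {A : Set Γ.Point} (hA : ∀ D : Γ.Divisor,
      (∀ a ∈ A, ∃ D', LinEquiv D' D ∧ Effective D' ∧ 1 ≤ D' a) →
      ∀ p, ∃ D', LinEquiv D' D ∧ Effective D' ∧ 1 ≤ D' p) : IsRankDetermining A := by
  intro D
  have h : ∀ r, Reaches A D r ↔ Reaches Set.univ D r := fun r =>
    ⟨Reaches.univ hA, fun h E hE hdeg _ => h E hE hdeg (Set.subset_univ _)⟩
  unfold Reaches at h
  simp only [rank, rankOn, h]

theorem isRankDetermining_vertices (hloop : ∀ e, Γ.src e ≠ Γ.tgt e) :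
    IsRankDetermining (Set.range (Point.vertex : Γ.V → Γ.Point)) :=
  isRankDetermining_of_forall fun _ h =>
    exists_ge_one_of_vertices hloop fun v => h _ ⟨v, rfl⟩

/-- A set is not rank determining if some divisor of rank `0` can reach all its points. -/
theorem not_isRankDetermining {B : Set Γ.Point} {D : Γ.Divisor} (hD : Effective D)
    (hB : ∀ a ∈ B, ∃ D', LinEquiv D' D ∧ Effective D' ∧ 1 ≤ D' a) {p : Γ.Point}
    (hp : ∀ D', LinEquiv D' D → Effective D' → ¬ 1 ≤ D' p) : ¬ IsRankDetermining B := by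
  classical
  intro h
  -- The contradiction is that the `B`-rank is at least `1`, while the rank is `0` because `p`
  -- cannot be reached.
  have hB1 : Reaches B D 1 := by
    intro E hE hdeg hEB
    obtain ⟨a, F, hF, hFdeg, rfl, ha⟩ := hE.exists_eq_add (r := 0) (by simpa using hdeg)
    obtain ⟨D', h1, h2, h3⟩ := hB a (hEB (Finset.mem_coe.2 ha))
    rw [hF.eq_zero_of_degree (by simpa using hFdeg), zero_add]
    exact ⟨D', h1.symm, (effective_sub_single_iff a).2 ⟨h2, h3⟩⟩
  have h0 : ∀ r, Reaches Set.univ D r → r = 0 := by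
    intro r hr
    by_contra hr0
    obtain ⟨D', h1, h2⟩ := hr (Finsupp.single p (r : ℤ))
      (fun q => by rw [Finsupp.single_apply]; split_ifs <;> positivity) (degree_single _ _)
      (Set.subset_univ _)
    have h3 : ∀ q, 0 ≤ D' q - (Finsupp.single p (r : ℤ)) q := h2
    refine hp D' h1.symm (fun q => ?_) ?_
    · have := h3 q
      rw [Finsupp.single_apply] at this
      split_ifs at this <;> omega
    · have := h3 p
      rw [Finsupp.single_eq_same] at this
      omega
  have h00 : Reaches Set.univ D 0 := fun E hE hdeg _ => ⟨D, LinEquiv.refl D, by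
    rwa [hE.eq_zero_of_degree (by simpa using hdeg), sub_zero]⟩
  have hrank : rank D = ((0 : ℤ) : WithTop ℤ) := by
    have hset : {x : WithTop ℤ | ∃ r : ℕ, x = ((r : ℤ) : WithTop ℤ) ∧ Reaches Set.univ D r}
        = {((0 : ℤ) : WithTop ℤ)} := by
      ext x
      constructor
      · rintro ⟨r, rfl, hr⟩
        rw [h0 r hr]; rfl
      · rintro rfl
        exact ⟨0, rfl, h00⟩
    rw [rank, rankOn, if_pos ⟨D, LinEquiv.refl D, hD⟩]
    refine (congrArg sSup hset).trans ?_
    exact csSup_singleton _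
  have hDB := h D
  rw [hrank, rankOn, if_pos ⟨D, LinEquiv.refl D, hD⟩] at hDB
  have h1 : ((1 : ℤ) : WithTop ℤ) ≤ ((0 : ℤ) : WithTop ℤ) := by
    rw [← hDB]
    exact le_csSup (OrderTop.bddAbove _) ⟨1, rfl, hB1⟩
  exact absurd (WithTop.coe_le_coe.1 h1) (by norm_num)

/-! ### Dhar's burning criterion. -/

open Classical in
/-- The sum over all ends of edges at `v` of a quantity depending on the edge and on its
other endpoint. -/
noncomputable def starSum (F : Γ.V → Γ.E → ℤ) (v : Γ.V) : ℤ :=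
  ∑ e ∈ Finset.univ.filter (fun e => Γ.src e = v), F (Γ.tgt e) e
    + ∑ e ∈ Finset.univ.filter (fun e => Γ.tgt e = v), F (Γ.src e) e

theorem HasInSlope.nonpos_of_min {f : ℝ → ℝ} {t : ℝ} {l : Filter ℝ} [l.NeBot]
    {m : ℤ} (hm : HasInSlope f t l m) (hl : l ≤ 𝓝[≠] t) (hmin : ∀ s, f t ≤ f s) : m ≤ 0 := by
  obtain ⟨s, h1, h2⟩ := (hm.and (hl self_mem_nhdsWithin)).exists
  have h4 : 0 < |t - s| := abs_pos.2 (sub_ne_zero.2 (Ne.symm h2))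
  have h3 : (m : ℝ) ≤ 0 := by
    by_contra h
    have := mul_pos (not_le.1 h) h4
    linarith [hmin s]
  exact_mod_cast h3

/-- The locus at which a piecewise linear function without interior zeros of negative order is
minimal propagates to the ends of an edge. -/
theorem min_propagates {φ : Γ.Point → ℝ} {o : Γ.Point → ℤ} (h : ∀ p, HasOrd φ p (o p))
    {e : Γ.E} (ho : ∀ t ht, 0 ≤ o (.inner e t ht)) {x : ℝ}
    (hmin : ∀ s, φ (Γ.edgePoint e x) ≤ φ (Γ.edgePoint e s)) :
    (0 ≤ x → x < Γ.len e → φ (.vertex (Γ.src e)) = φ (Γ.edgePoint e x)) ∧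
    (0 < x → x ≤ Γ.len e → φ (.vertex (Γ.tgt e)) = φ (Γ.edgePoint e x)) := by
  set f := φ ∘ Γ.edgePoint e with hf
  have h' : ∀ p, ∃ m, HasOrd φ p m := fun p => ⟨_, h p⟩
  have key : ∀ s, 0 < s → s < Γ.len e → f s = f x →
      HasInSlope f s (𝓝[<] s) 0 ∧ HasInSlope f s (𝓝[>] s) 0 := by
    intro s h0 h1 hs
    obtain ⟨a, b, ha, hb, hab⟩ := h (.inner e s ⟨h0, h1⟩)
    have hms : ∀ y, f s ≤ f y := fun y => hs ▸ hmin y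
    have ha0 := ha.nonpos_of_min (nhdsWithin_mono _ fun x hx => ne_of_lt hx) hms
    have hb0 := hb.nonpos_of_min (nhdsWithin_mono _ fun x hx => ne_of_gt hx) hms
    have := ho s ⟨h0, h1⟩
    obtain rfl : a = 0 := by omega
    obtain rfl : b = 0 := by omega
    exact ⟨ha, hb⟩
  constructor
  · intro h0 h1
    obtain ⟨s, hs0, hsx, hs, hs'⟩ := exists_left_end h0 (exists_slope_right h' e) (c := f x) rfl
    rcases hs0.eq_or_lt with rfl | hs0
    · rw [← edgePoint_zero]
      exact hs
    · exact (hs'.elim hs0.ne' fun hn => hn (key s hs0 (hsx.trans_lt h1) hs).1).elim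
  · intro h0 h1
    obtain ⟨s, hs0, hsx, hs, hs'⟩ := exists_left_end (f := fun y => f (Γ.len e - y))
      (t := Γ.len e - x) (c := f x) (sub_nonneg.2 h1) (fun y => by
        obtain ⟨m, hm⟩ := exists_slope_left h' e (Γ.len e - y)
        have := hm.reflect_left (c := Γ.len e)
        rw [sub_sub_cancel] at this
        exact ⟨m, this⟩) (by rw [sub_sub_cancel])
    rcases hs0.eq_or_lt with rfl | hs0
    · rw [← edgePoint_len]
      simpa only [hf, Function.comp_apply, sub_zero] using hs
    · refine (hs'.elim hs0.ne' fun hn => hn ?_).elim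
      exact HasInSlope.reflect_right (c := Γ.len e)
        (by simpa only [sub_sub_cancel] using (key _ (by linarith) (by linarith) hs).2)

/-- Needed for a minimum of `φ` on each edge to exist; `min_propagates` then carries it to a vertex.
-/
theorem continuous_edge {φ : Γ.Point → ℝ} (h : ∀ p, ∃ m, HasOrd φ p m) (e : Γ.E) :
    Continuous (φ ∘ Γ.edgePoint e) := by
  refine continuous_iff_continuousAt.2 fun x => continuousAt_iff_continuous_left'_right'.2 ⟨?_, ?_⟩
  · obtain ⟨a, ha⟩ := exists_slope_left h e x
    exact ha.tendsto nhdsWithin_le_nhds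
  · obtain ⟨a, ha⟩ := exists_slope_right h e x
    exact ha.tendsto nhdsWithin_le_nhds

theorem exists_edgePoint_eq (e : Γ.E) (x : ℝ) :
    ∃ y ∈ Set.Icc 0 (Γ.len e), Γ.edgePoint e y = Γ.edgePoint e x := by
  rcases le_or_gt x 0 with h0 | h0
  · exact ⟨0, ⟨le_rfl, (Γ.len_pos e).le⟩, by
      rw [edgePoint_of_nonpos e le_rfl, edgePoint_of_nonpos e h0]⟩
  rcases le_or_gt x (Γ.len e) with h1 | h1
  · exact ⟨x, ⟨h0.le, h1⟩, rfl⟩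
  · exact ⟨Γ.len e, ⟨(Γ.len_pos e).le, le_rfl⟩,
      by
      rw [edgePoint_of_len_le e le_rfl, edgePoint_of_len_le e h1.le]⟩

open Classical in
/-- Dhar's burning criterion, in the form of an obstruction: if `D` is supported on vertices and
is equivalent to an effective divisor with a chip at `v₀`, where `D` has none, then there is a
nonempty set of vertices avoiding `v₀` which can legally fire. -/
theorem exists_firing_set {D D' : Γ.Divisor} (hDD' : LinEquiv D' D) (hD' : Effective D')
    (hinner : ∀ e t ht, D (.inner e t ht) = 0) {v₀ : Γ.V} (h0 : D (.vertex v₀) ≤ 0)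
    (h1 : 1 ≤ D' (.vertex v₀)) :
    ∃ S : Set Γ.V, S.Nonempty ∧ v₀ ∉ S ∧
      ∀ v ∈ S, starSum (fun w _ => if w ∈ S then 0 else 1) v ≤ D (.vertex v) := by
  obtain ⟨φ, hφ⟩ := hDD'
  have hφ' : ∀ p, ∃ m, HasOrd φ p m := fun p => ⟨_, hφ p⟩
  have ho : ∀ e t ht, 0 ≤ (D' - D) (.inner e t ht) := fun e t ht => by
    rw [Finsupp.sub_apply, hinner, sub_zero]
    exact hD' _
  obtain ⟨v₁, hv₁⟩ : ∃ v, ∀ w, φ (.vertex v) ≤ φ (.vertex w) :=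
    haveI := Γ.nonempty
    Finite.exists_min fun v : Γ.V => φ (.vertex v)
  have hge : ∀ e x, φ (.vertex v₁) ≤ φ (Γ.edgePoint e x) := by
    intro e x
    obtain ⟨y, hy, hmin⟩ := isCompact_Icc.exists_isMinOn
      (Set.nonempty_Icc.2 (Γ.len_pos e).le) (continuous_edge hφ' e).continuousOn
    have hmin' : ∀ s, φ (Γ.edgePoint e y) ≤ φ (Γ.edgePoint e s) := by
      intro s
      obtain ⟨s', hs', heq⟩ := exists_edgePoint_eq e s
      rw [← heq]
      exact hmin hs'
    refine le_trans ?_ (hmin' x)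
    rcases hy.2.eq_or_lt with rfl | hlt
    · rw [edgePoint_len]
      exact hv₁ _
    · rw [← (min_propagates hφ (ho e) hmin').1 hy.1 hlt]
      exact hv₁ _
  -- The firing set is the set of vertices at which `φ` is minimal, where `D' = D + div φ`.
  set S : Set Γ.V := {v | φ (.vertex v) = φ (.vertex v₁)} with hS
  have hbound : ∀ v ∈ S,
      starSum (fun w _ => if w ∈ S then 0 else 1) v ≤ D (.vertex v) - D' (.vertex v) := by
    intro v hv
    obtain ⟨a, b, ha, hb, hab⟩ := hφ (.vertex v)
    -- All slopes leaving a minimum are nonnegative. A zero slope along an edge would carry the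
    -- minimum to its other end, so edges leaving `S` have outgoing slope at least `1`.
    have ha' : ∀ e, Γ.src e = v → (if Γ.tgt e ∈ S then (0 : ℤ) else 1) ≤ -a e := by
      intro e he
      have hmin : ∀ s, φ (Γ.edgePoint e 0) ≤ φ (Γ.edgePoint e s) := fun s => by
        rw [edgePoint_zero, he, show φ (.vertex v) = _ from hv]
        exact hge e s
      have hle := (ha e he).nonpos_of_min (nhdsWithin_mono _ fun x hx => ne_of_gt hx) hmin
      split_ifs with ht
      · omega
      by_contra hlt
      have h0 : a e = 0 := by omega
      have hev := ha e he
      rw [h0] at hev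
      obtain ⟨x, hx, hx0, hx1⟩ := (hev.and (Ioo_mem_nhdsGT (Γ.len_pos e))).exists
      rw [Int.cast_zero, zero_mul, add_zero] at hx
      have hx' : φ (Γ.edgePoint e 0) = φ (Γ.edgePoint e x) := hx
      have := (min_propagates hφ (ho e) (fun s => hx' ▸ hmin s)).2 hx0 hx1.le
      rw [← hx', edgePoint_zero, he] at this
      exact ht (this.trans hv)
    have hb' : ∀ e, Γ.tgt e = v → (if Γ.src e ∈ S then (0 : ℤ) else 1) ≤ -b e := by
      intro e he
      have hmin : ∀ s, φ (Γ.edgePoint e (Γ.len e)) ≤ φ (Γ.edgePoint e s) := fun s => by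
        rw [edgePoint_len, he, show φ (.vertex v) = _ from hv]
        exact hge e s
      have hle := (hb e he).nonpos_of_min (nhdsWithin_mono _ fun x hx => ne_of_lt hx) hmin
      split_ifs with ht
      · omega
      by_contra hlt
      have h0 : b e = 0 := by omega
      have hev := hb e he
      rw [h0] at hev
      obtain ⟨x, hx, hx0, hx1⟩ := (hev.and (Ioo_mem_nhdsLT (Γ.len_pos e))).exists
      rw [Int.cast_zero, zero_mul, add_zero] at hx
      have hx' : φ (Γ.edgePoint e (Γ.len e)) = φ (Γ.edgePoint e x) := hx
      have := (min_propagates hφ (ho e) (fun s => hx' ▸ hmin s)).1 hx0.le hx1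
      rw [← hx', edgePoint_len, he] at this
      exact ht (this.trans hv)
    rw [← neg_sub, ← Finsupp.sub_apply, hab, neg_add, ← Finset.sum_neg_distrib,
      ← Finset.sum_neg_distrib]
    exact add_le_add (Finset.sum_le_sum fun e he => ha' e (Finset.mem_filter.1 he).2)
      (Finset.sum_le_sum fun e he => hb' e (Finset.mem_filter.1 he).2)
  refine ⟨S, ⟨v₁, rfl⟩, fun hv => ?_, fun v hv => ?_⟩
  -- If `v₀` were in `S`, it could only lose chips in passing from `D` to `D'`, but it gains one.
  · have h2 := hbound v₀ hv
    have h3 : 0 ≤ starSum (fun w _ => if w ∈ S then 0 else 1) v₀ :=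
      add_nonneg (Finset.sum_nonneg fun e _ => by dsimp only; split_ifs <;> norm_num)
        (Finset.sum_nonneg fun e _ => by dsimp only; split_ifs <;> norm_num)
    omega
  · have h2 := hbound v hv
    have h3 := hD' (.vertex v)
    omega

/-! ### Moving chips along a potential on the vertices. -/

/-- The incoming slope at an end of an edge of length `l` of the function which rises with slope
`1` from the lower end until it reaches the value at the higher end; here `x` is the difference
of the values at this end and at the other one. -/
noncomputable def endSlope (x l : ℝ) : ℤ := if x < 0 then -1 else if x = l then 1 else 0

/-- The function on `[0, l]` which rises with slope `1` from the lower of the values `a` at `0`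
and `b` at `l` until it reaches the higher one. -/
noncomputable def ramp (a b l t : ℝ) : ℝ := min (min (t - -a) (b + l - t)) (max a b)

theorem ramp_zero {a b l : ℝ} (h : |a - b| ≤ l) : ramp a b l 0 = a := by
  rw [ramp, zero_sub, neg_neg, sub_zero, min_eq_left (show a ≤ b + l by linarith [(abs_le.1 h).2]),
    min_eq_left (le_max_left _ _)]

theorem ramp_reflect (a b l t : ℝ) : ramp a b l (l - t) = ramp b a l t := by
  unfold ramp
  rw [max_comm a b, min_comm (t - -b)]
  congr 2 <;> ring

theorem ramp_len {a b l : ℝ} (h : |a - b| ≤ l) : ramp a b l l = b := by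
  have := ramp_reflect a b l 0
  rwa [sub_zero, ramp_zero (by rwa [abs_sub_comm])] at this

/-- A ramp is a minimum of affine functions, so no chips are needed inside the edge. The form `t -
-a` in `ramp` fits `ordGE_sub`. -/
theorem ordGE_ramp (a b l t : ℝ) : OrdGE (ramp a b l) t 0 :=
  ((ordGE_sub _ t).min (ordGE_sub' _ t)).min (ordGE_const _ t)

theorem ramp_slope_zero {a b l : ℝ} (hl : 0 < l) (h : |a - b| ≤ l) :
    HasInSlope (ramp a b l) 0 (𝓝[>] 0) (endSlope (a - b) l) := by
  have h1 := hasInSlope_right_sub (-a) 0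
  have h2 := hasInSlope_right_sub' (b + l) 0
  have h3 := hasInSlope_const (max a b) 0 (𝓝[>] 0)
  have h4 := abs_le.1 h
  rcases (show a ≤ b + l by linarith).eq_or_lt with heq | hlt
  · have hba : b ≤ a := by linarith
    have h5 := (h1.min_of_eq h2 (by linarith)).min_of_eq h3 (by
      rw [max_eq_left hba, min_eq_left (by linarith)]; ring)
    have h6 : endSlope (a - b) l = 1 := by
      rw [endSlope, if_neg (by linarith), if_pos (by linarith)]
    rw [h6]
    exact h5
  · have h5 := h1.min_of_lt nhdsWithin_le_nhds h2 (by linarith)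
    rcases lt_or_ge a b with hab | hab
    · have h6 := h5.min_of_lt nhdsWithin_le_nhds h3 (by
        rw [max_eq_right hab.le, min_eq_left (by linarith)]; linarith)
      have h7 : endSlope (a - b) l = -1 := by rw [endSlope, if_pos (by linarith)]
      rw [h7]
      exact h6
    · have h6 := h5.min_of_eq h3 (by
        rw [max_eq_left hab, min_eq_left (by linarith)]; ring)
      have h7 : endSlope (a - b) l = 0 := by
        rw [endSlope, if_neg (by linarith), if_neg (by intro h; linarith)]
      rw [h7]
      exact h6

/-- Moving chips along a potential on the vertices. -/
theorem exists_move_potential {D : Γ.Divisor} (hD : Effective D) {h : Γ.V → ℝ}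
    (hlen : ∀ e, |h (Γ.src e) - h (Γ.tgt e)| ≤ Γ.len e)
    (hv : ∀ v, 0 ≤ D (.vertex v) + starSum (fun w e => endSlope (h v - h w) (Γ.len e)) v) :
    ∃ D', LinEquiv D' D ∧ Effective D' ∧ ∀ v, D' (.vertex v) =
      D (.vertex v) + starSum (fun w e => endSlope (h v - h w) (Γ.len e)) v := by
  classical
  set F : Γ.E → ℝ → ℝ := fun e => ramp (h (Γ.src e)) (h (Γ.tgt e)) (Γ.len e) with hF
  have hF0 : ∀ e, F e 0 = h (Γ.src e) := fun e => ramp_zero (hlen e)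
  have hF1 : ∀ e, F e (Γ.len e) = h (Γ.tgt e) := fun e => ramp_len (hlen e)
  have hvert : ∀ v, HasOrd (edgewise h F) (.vertex v)
      (starSum (fun w e => endSlope (h v - h w) (Γ.len e)) v) := by
    intro v
    have := hasOrd_edgewise_vertex hF0 hF1 v
      (fun e => ramp_slope_zero (Γ.len_pos e) (hlen e)) (fun e => by
        have h2 : |h (Γ.tgt e) - h (Γ.src e)| ≤ Γ.len e := by
          rw [abs_sub_comm]; exact hlen e
        refine HasInSlope.reflect_right (c := Γ.len e) ?_
        rw [sub_self]
        refine (ramp_slope_zero (Γ.len_pos e) h2).congr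
          (Eventually.of_forall fun s => (ramp_reflect _ _ _ s).symm) (ramp_reflect _ _ _ 0).symm)
    convert this using 1
    unfold starSum
    congr 1
    · exact Finset.sum_congr rfl fun e he => by rw [(Finset.mem_filter.1 he).2]
    · exact Finset.sum_congr rfl fun e he => by rw [(Finset.mem_filter.1 he).2]
  have key : ∀ p, ∃ m, HasOrd (edgewise h F) p m ∧ 0 ≤ D p + m := by
    rintro (v | ⟨e, t, ht⟩)
    · exact ⟨_, hvert v, hv v⟩
    · obtain ⟨a, b, ha, hb, hab⟩ := ordGE_ramp (h (Γ.src e)) (h (Γ.tgt e)) (Γ.len e) t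
      refine ⟨_, hasOrd_edgewise_inner (hF0 e) (hF1 e) ht ha hb, ?_⟩
      have := hD (.inner e t ht)
      omega
  choose m hm hge using key
  obtain ⟨G, hG⟩ := exists_divisor fun p => ⟨_, hm p⟩
  refine ⟨D + G, ⟨_, fun p => by simpa using hG p⟩, fun p => ?_, fun v => ?_⟩
  · rw [Finsupp.add_apply, (hG p).unique (hm p)]
    exact hge p
  · rw [Finsupp.add_apply, (hG _).unique (hvert v)]

/-- The divisor with prescribed multiplicities at the vertices. -/
noncomputable def vertexDivisor (δ : Γ.V → ℤ) : Γ.Divisor :=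
  ∑ v, Finsupp.single (.vertex v) (δ v)

theorem vertexDivisor_vertex (δ : Γ.V → ℤ) (v : Γ.V) :
    vertexDivisor δ (.vertex v : Γ.Point) = δ v := by
  classical
  simp [vertexDivisor, Finsupp.finsetSum_apply, Finsupp.single_apply]

theorem vertexDivisor_inner (δ : Γ.V → ℤ) (e : Γ.E) (t : ℝ) (ht : t ∈ Set.Ioo 0 (Γ.len e)) :
    vertexDivisor δ (.inner e t ht : Γ.Point) = 0 := by
  classical
  simp [vertexDivisor, Finsupp.finsetSum_apply]

theorem effective_vertexDivisor {δ : Γ.V → ℤ} (h : ∀ v, 0 ≤ δ v) :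
    Effective (vertexDivisor δ : Γ.Divisor) := by
  rintro (v | ⟨e, t, ht⟩)
  · rw [vertexDivisor_vertex]; exact h v
  · rw [vertexDivisor_inner]

/-! ### The Euler characteristic. -/

open Classical in
theorem boundary_single (e : Γ.E) : Γ.boundary (Pi.single e 1) =
    (Pi.single (Γ.tgt e) 1 : Γ.V → ℤ) - Pi.single (Γ.src e) 1 := by
  simp [boundary, Pi.single_apply]

/-- The Euler characteristic formula for the genus. -/
theorem genus_add_card : Γ.genus + Fintype.card Γ.V = Fintype.card Γ.E + 1 := by
  classical
  let s : (Γ.V → ℤ) →ₗ[ℤ] ℤ := ∑ v, LinearMap.proj v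
  have hs : ∀ f, s f = ∑ v, f v := fun f => by simp [s]
  -- Connectedness enters here: differences of any two vertices are boundaries, and they generate
  -- the functions with sum `0`. Rank–nullity for `∂` and for the sum map then gives the formula.
  have hrange : LinearMap.range Γ.boundary = LinearMap.ker s := by
    apply le_antisymm
    · rintro _ ⟨f, rfl⟩
      rw [LinearMap.mem_ker, hs]
      simp only [boundary, LinearMap.sum_apply, LinearMap.smulRight_apply, LinearMap.proj_apply,
        Finset.sum_apply, Pi.smul_apply, Pi.sub_apply]
      rw [Finset.sum_comm]
      refine Finset.sum_eq_zero fun e _ => ?_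
      rw [← Finset.smul_sum, Finset.sum_sub_distrib]
      simp
    · intro f hf
      rw [LinearMap.mem_ker, hs] at hf
      have hgen : ∀ a b, Relation.EqvGen (fun x y => ∃ e, Γ.src e = x ∧ Γ.tgt e = y) a b →
          (Pi.single b 1 : Γ.V → ℤ) - Pi.single a 1 ∈ LinearMap.range Γ.boundary := by
        intro a b hab
        induction hab with
        | rel a b h =>
          obtain ⟨e, rfl, rfl⟩ := h
          exact ⟨_, boundary_single e⟩
        | refl a => simp
        | symm a b _ ih => simpa using Submodule.neg_mem _ ih
        | trans a b c _ _ ih1 ih2 => simpa using Submodule.add_mem _ ih2 ih1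
      obtain ⟨v₀⟩ := Γ.nonempty
      have hf' : f = ∑ v, f v • ((Pi.single v 1 : Γ.V → ℤ) - Pi.single v₀ 1) := by
        simp only [smul_sub, Finset.sum_sub_distrib, ← Finset.sum_smul, hf, zero_smul, sub_zero]
        ext w
        simp [Finset.sum_apply, Pi.single_apply]
      rw [hf']
      exact Submodule.sum_mem _ fun v _ => Submodule.smul_mem _ _ (hgen _ _ (Γ.connected _ _))
  have hsurj : LinearMap.range s = ⊤ := by
    rw [LinearMap.range_eq_top]
    intro n
    obtain ⟨v₀⟩ := Γ.nonempty
    exact ⟨Pi.single v₀ n, by rw [hs]; simp⟩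
  have h1 := Submodule.finrank_quotient_add_finrank (LinearMap.ker Γ.boundary)
  have h2 := Submodule.finrank_quotient_add_finrank (LinearMap.ker s)
  rw [Γ.boundary.quotKerEquivRange.finrank_eq] at h1
  rw [s.quotKerEquivRange.finrank_eq] at h2
  rw [hsurj, finrank_top, Module.finrank_self, Module.finrank_fintype_fun_eq_card] at h2
  rw [hrange, Module.finrank_fintype_fun_eq_card] at h1
  unfold genus
  omega

theorem neg_one_le_endSlope (x l : ℝ) : -1 ≤ endSlope x l := by
  unfold endSlope; split_ifs <;> norm_num

theorem endSlope_nonneg {x l : ℝ} (h : 0 ≤ x) : 0 ≤ endSlope x l := by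
  unfold endSlope
  rw [if_neg h.not_gt]; split_ifs <;> norm_num

theorem endSlope_self {x l : ℝ} (hl : 0 < l) (h : x = l) : endSlope x l = 1 := by
  rw [endSlope, if_neg (by linarith), if_pos h]

/-! ### Cyclic graphs with alternately single and double edges. -/

/-- The edge `e` joins `x` and `y`. -/
def Joins (Γ : MetricGraph) (e : Γ.E) (x y : Γ.V) : Prop :=
  (Γ.src e = x ∧ Γ.tgt e = y) ∨ (Γ.src e = y ∧ Γ.tgt e = x)

/-- A cyclic labelling `p 0 - q 0 = p 1 - q 1 = ⋯ - q (n - 1) = p n = p 0` of the vertices of a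
graph whose edges are, cyclically, alternately single and double. -/
structure CyclicLabelling (Γ : MetricGraph) (n : ℕ) where
  p : ℕ → Γ.V
  q : ℕ → Γ.V
  c : ℕ → Γ.E
  d : ℕ → Fin 2 → Γ.E
  p_period : p n = p 0
  q_period : q n = q 0
  index : Γ.V → ℕ
  isP : Γ.V → Bool
  index_p : ∀ j < n, index (p j) = j ∧ isP (p j) = true
  index_q : ∀ j < n, index (q j) = j ∧ isP (q j) = false
  cover : ∀ v, ∃ j < n, v = p j ∨ v = q j
  edges : ∀ e, ∃ j < n, (e = c j ∧ Γ.Joins e (p j) (q j)) ∨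
    ∃ s, e = d j s ∧ Γ.Joins e (q j) (p (j + 1))
  star_p : ∀ (F : Γ.V → Γ.E → ℤ) j,
    starSum F (p (j + 1)) = F (q (j + 1)) (c (j + 1)) + ∑ s, F (q j) (d j s)
  star_q : ∀ (F : Γ.V → Γ.E → ℤ) j,
    starSum F (q j) = F (p j) (c j) + ∑ s, F (p (j + 1)) (d j s)

namespace CyclicLabelling
variable {n : ℕ} (L : CyclicLabelling Γ n)

/-- A function on the vertices given by its values in terms of the labels. -/
def assign {β : Type} (a b : ℕ → β) (v : Γ.V) : β :=
  if L.isP v then a (L.index v) else b (L.index v)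

theorem assign_p {β : Type} (a b : ℕ → β) {j : ℕ} (hj : j < n) : L.assign a b (L.p j) = a j := by
  rw [assign, (L.index_p j hj).1, (L.index_p j hj).2, if_pos rfl]

theorem assign_q {β : Type} (a b : ℕ → β) {j : ℕ} (hj : j < n) : L.assign a b (L.q j) = b j := by
  rw [assign, (L.index_q j hj).1, (L.index_q j hj).2, if_neg (by simp)]

/-- The divisor `q 0 + ∑ j, q j`. -/
noncomputable def chips : Γ.Divisor :=
  vertexDivisor (L.assign (fun _ => 0) fun j => if j = 0 then 2 else 1)

theorem chips_p {j : ℕ} (hj : j < n) : L.chips (.vertex (L.p j)) = 0 := by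
  rw [chips, vertexDivisor_vertex, assign_p _ _ _ hj]

theorem chips_q {j : ℕ} (hj : j < n) : L.chips (.vertex (L.q j)) = if j = 0 then 2 else 1 := by
  rw [chips, vertexDivisor_vertex, assign_q _ _ _ hj]

theorem effective_chips : Effective L.chips :=
  effective_vertexDivisor fun v => by
    unfold assign; dsimp only; split_ifs <;> norm_num

theorem chips_unreachable (hn : 0 < n) {D' : Γ.Divisor} (hD' : LinEquiv D' L.chips)
    (hE : Effective D') : ¬ 1 ≤ D' (.vertex (L.p 0)) := by
  classical
  intro h1
  obtain ⟨S, ⟨v, hv⟩, h0, hS⟩ := exists_firing_set hD' hE (fun e t ht => vertexDivisor_inner _ e t ht)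
    (L.chips_p hn).le h1
  have hterm : ∀ w : Γ.V, 0 ≤ (if w ∈ S then (0 : ℤ) else 1) := fun w => by
    split_ifs <;> norm_num
  -- Two parallel edges out of `S` cost two chips, and `q j` has only one when `j > 0`.
  have hq : ∀ j, 0 < j → j < n → L.p (j + 1) ∉ S → L.q j ∉ S := by
    intro j h0 hj hp hq
    have := hS _ hq
    rw [L.star_q, L.chips_q hj, if_neg h0.ne', Fin.sum_univ_two, if_neg hp] at this
    have := hterm (L.p j)
    omega
  have hp : ∀ j, 0 < j → j < n → L.q j ∉ S → L.p j ∉ S := by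
    intro j h0 hj hq hp
    obtain ⟨i, rfl⟩ : ∃ i, j = i + 1 := ⟨j - 1, by omega⟩
    have := hS _ hp
    rw [L.star_p, L.chips_p hj, if_neg hq, Fin.sum_univ_two] at this
    have := hterm (L.q i)
    omega
  have hp' : ∀ j, j ≤ n → L.p j ∉ S := by
    intro j hj
    -- The fire runs downwards from `p n`, which is the source `p 0` by periodicity.
    refine Nat.decreasingInduction (motive := fun k _ => L.p k ∉ S) (fun k hk ih => ?_) ?_ hj
    · rcases Nat.eq_zero_or_pos k with rfl | hk0
      · exact h0
      · exact hp k hk0 hk (hq k hk0 hk ih)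
    · rwa [L.p_period]
  -- Firing `q 0` would send a chip along all three of its edges, but it has two.
  have hq0 : L.q 0 ∉ S := by
    intro hq
    have := hS _ hq
    rw [L.star_q, L.chips_q hn, if_pos rfl, Fin.sum_univ_two, if_neg h0,
      if_neg (hp' 1 hn)] at this
    omega
  obtain ⟨j, hj, rfl | rfl⟩ := L.cover v
  · exact hp' j hj.le hv
  · rcases Nat.eq_zero_or_pos j with rfl | hj0
    · exact hq0 hv
    · exact hq j hj0 hj (hp' _ hj) hv

/-! ### The potential that moves a chip to `p (K + 1)`. -/

/-- The length of the shorter one of two parallel edges. -/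
noncomputable def gap (j : ℕ) : ℝ := min (Γ.len (L.d j 0)) (Γ.len (L.d j 1))

/-- The distance from `q 0` to `q j`, along the path through `p 1`. -/
noncomputable def dist : ℕ → ℝ
  | 0 => 0
  | j + 1 => dist j + L.gap j + Γ.len (L.c (j + 1))

theorem gap_pos (j : ℕ) : 0 < L.gap j := lt_min (Γ.len_pos _) (Γ.len_pos _)

theorem gap_le (j : ℕ) (s : Fin 2) : L.gap j ≤ Γ.len (L.d j s) := by
  fin_cases s
  · exact min_le_left _ _
  · exact min_le_right _ _

theorem dist_nonneg (j : ℕ) : 0 ≤ L.dist j := by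
  induction j with
  | zero => exact le_rfl
  | succ j ih => exact add_nonneg (add_nonneg ih (L.gap_pos j).le) (Γ.len_pos _).le

/-- The shorter one of two parallel edges has full slope. -/
theorem one_le_sum_endSlope {x : ℝ} {j : ℕ} (hx : x = L.gap j) :
    1 ≤ ∑ s, endSlope x (Γ.len (L.d j s)) := by
  have h0 : 0 ≤ x := hx ▸ (L.gap_pos j).le
  rw [Fin.sum_univ_two]
  have h1 := endSlope_nonneg (l := Γ.len (L.d j 0)) h0
  have h2 := endSlope_nonneg (l := Γ.len (L.d j 1)) h0
  rcases min_choice (Γ.len (L.d j 0)) (Γ.len (L.d j 1)) with h | h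
  · have := endSlope_self (Γ.len_pos (L.d j 0)) (hx.trans h)
    omega
  · have := endSlope_self (Γ.len_pos (L.d j 1)) (hx.trans h)
    omega

theorem neg_two_le_sum_endSlope (x : ℝ) (j : ℕ) :
    -2 ≤ ∑ s, endSlope x (Γ.len (L.d j s)) := by
  rw [Fin.sum_univ_two]
  have h1 := neg_one_le_endSlope x (Γ.len (L.d j 0))
  have h2 := neg_one_le_endSlope x (Γ.len (L.d j 1))
  omega

theorem sum_endSlope_nonneg {x : ℝ} (hx : 0 ≤ x) (j : ℕ) :
    0 ≤ ∑ s, endSlope x (Γ.len (L.d j s)) :=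
  Finset.sum_nonneg fun _ _ => endSlope_nonneg hx

/-- The distance of `p (K + 1)` from the arc from `q (K + 1)` to `q 0` through `p 0`. -/
noncomputable def height (K : ℕ) : ℝ := min (L.dist K + L.gap K) (Γ.len (L.c (K + 1)))

/-- The values of the potential at the vertices `p j`. -/
noncomputable def potP (K : ℕ) : ℕ → ℝ
  | 0 => 0
  | j + 1 => if j ≤ K then min (L.dist j + L.gap j) (L.height K) else 0

/-- The values of the potential at the vertices `q j`. -/
noncomputable def potQ (K j : ℕ) : ℝ := if j ≤ K then min (L.dist j) (L.height K) else 0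

theorem height_pos (K : ℕ) : 0 < L.height K :=
  lt_min (add_pos_of_nonneg_of_pos (L.dist_nonneg K) (L.gap_pos K)) (Γ.len_pos _)

theorem potQ_zero (K : ℕ) : L.potQ K 0 = 0 := by
  rw [potQ, if_pos (Nat.zero_le K)]
  exact min_eq_left (L.height_pos K).le

theorem potP_of_lt {K j : ℕ} (h : K + 1 < j) : L.potP K j = 0 := by
  obtain ⟨i, rfl⟩ : ∃ i, j = i + 1 := ⟨j - 1, by omega⟩
  exact if_neg (by omega)

theorem potQ_of_lt {K j : ℕ} (h : K < j) : L.potQ K j = 0 := if_neg (by omega)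

theorem potP_top (K : ℕ) : L.potP K (K + 1) = L.height K := by
  rw [potP, if_pos le_rfl]
  exact min_eq_right (min_le_left _ _)

/-- Truncation at `height K` does not increase differences, so the untruncated distances give the
bound. For `j = K + 1` the bound is instead built into `height`. -/
theorem abs_potP_sub_potQ (K j : ℕ) : |L.potP K j - L.potQ K j| ≤ Γ.len (L.c j) := by
  rcases j with _ | j
  · rw [potQ_zero, potP, sub_zero, abs_zero]
    exact (Γ.len_pos _).le
  have hc := Γ.len_pos (L.c (j + 1))
  rcases lt_trichotomy j K with h | rfl | h
  · rw [potP, potQ, if_pos h.le, if_pos (by omega), dist]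
    refine (abs_min_sub_min_le_max _ _ _ _).trans ?_
    rw [sub_self, abs_zero, sub_add_cancel_left, abs_neg, abs_of_pos hc, max_eq_left hc.le]
  · rw [potP_top, L.potQ_of_lt (Nat.lt_succ_self j), sub_zero, abs_of_pos (L.height_pos j)]
    exact min_le_right _ _
  · rw [L.potP_of_lt (by omega), L.potQ_of_lt (by omega), sub_zero, abs_zero]
    exact hc.le

theorem abs_potQ_sub_potP (K j : ℕ) : |L.potQ K j - L.potP K (j + 1)| ≤ L.gap j := by
  have hc := L.gap_pos j
  rcases le_or_gt j K with h | h
  · rw [potP, potQ, if_pos h, if_pos h]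
    refine (abs_min_sub_min_le_max _ _ _ _).trans ?_
    rw [sub_self, abs_zero, sub_add_cancel_left, abs_neg, abs_of_pos hc, max_eq_left hc.le]
  · rw [L.potP_of_lt (by omega), L.potQ_of_lt (by omega), sub_zero, abs_zero]
    exact hc.le

/-- The order at `p (j + 1)` of the function defined by the potential. -/
theorem order_p (K j : ℕ) :
    (if j = K then 1 else 0) ≤
      endSlope (L.potP K (j + 1) - L.potQ K (j + 1)) (Γ.len (L.c (j + 1))) +
      ∑ s, endSlope (L.potP K (j + 1) - L.potQ K j) (Γ.len (L.d j s)) := by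
  have hg := L.gap_pos j
  rcases lt_trichotomy j K with h | rfl | h
  · rw [if_neg h.ne, potP, potQ, potQ, if_pos h.le, if_pos h.le, if_pos (by omega)]
    -- Either `p (j + 1)` has the maximal potential and loses nothing, or a chip arriving over a
    -- shortest parallel edge pays for the one leaving along the single edge.
    rcases le_or_gt (L.height K) (L.dist j + L.gap j) with hT | hT
    · refine add_nonneg (endSlope_nonneg ?_) (L.sum_endSlope_nonneg ?_ j)
      · rw [min_eq_right hT]
        exact sub_nonneg.2 (min_le_right _ _)
      · rw [min_eq_right hT]
        exact sub_nonneg.2 (min_le_right _ _)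
    · have h1 := L.one_le_sum_endSlope (j := j)
        (x := min (L.dist j + L.gap j) (L.height K) - min (L.dist j) (L.height K)) (by
          rw [min_eq_left hT.le, min_eq_left (by linarith)]; ring)
      have h2 := neg_one_le_endSlope (min (L.dist j + L.gap j) (L.height K) -
        min (L.dist (j + 1)) (L.height K)) (Γ.len (L.c (j + 1)))
      omega
  · rw [if_pos rfl, potP_top, L.potQ_of_lt (Nat.lt_succ_self j), potQ, if_pos le_rfl, sub_zero]
    have h1 := endSlope_nonneg (l := Γ.len (L.c (j + 1))) (L.height_pos j).le
    have h2 := L.sum_endSlope_nonneg (x := L.height j - min (L.dist j) (L.height j))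
      (sub_nonneg.2 (min_le_right _ _)) j
    -- At `p (K + 1)` a chip arrives over a parallel edge or over the single edge, depending on
    -- which term of the minimum is attained.
    rcases min_choice (L.dist j + L.gap j) (Γ.len (L.c (j + 1))) with h | h
    · have h' : L.height j = L.dist j + L.gap j := h
      have := L.one_le_sum_endSlope (j := j) (x := L.height j - min (L.dist j) (L.height j)) (by
        rw [h', min_eq_left (by linarith)]; ring)
      omega
    · have := endSlope_self (Γ.len_pos (L.c (j + 1))) h
      rw [height] at *
      omega
  · rw [if_neg h.ne', L.potP_of_lt (by omega), L.potQ_of_lt (by omega), L.potQ_of_lt h, sub_zero]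
    exact add_nonneg (endSlope_nonneg le_rfl) (L.sum_endSlope_nonneg le_rfl j)

/-- The order at `q j` of the function defined by the potential. -/
theorem order_q (K j : ℕ) :
    0 ≤ (if j = 0 then 2 else 1) + (endSlope (L.potQ K j - L.potP K j) (Γ.len (L.c j)) +
      ∑ s, endSlope (L.potQ K j - L.potP K (j + 1)) (Γ.len (L.d j s))) := by
  rcases j with _ | j
  · have h1 := L.neg_two_le_sum_endSlope (L.potQ K 0 - L.potP K (0 + 1)) 0
    have h2 := endSlope_nonneg (x := L.potQ K 0 - L.potP K 0) (l := Γ.len (L.c 0)) (by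
      rw [potQ_zero, potP, sub_zero])
    rw [if_pos rfl]
    omega
  rw [if_neg (Nat.succ_ne_zero j)]
  have hc := Γ.len_pos (L.c (j + 1))
  rcases lt_trichotomy j K with h | rfl | h
  · rcases le_or_gt (L.height K) (L.dist (j + 1)) with hT | hT
    · have h1 : L.potQ K (j + 1) = L.height K := by
        rw [potQ, if_pos (by omega), min_eq_right hT]
      have h2 := endSlope_nonneg (x := L.potQ K (j + 1) - L.potP K (j + 1))
        (l := Γ.len (L.c (j + 1))) (by
          rw [h1, potP, if_pos h.le]; exact sub_nonneg.2 (min_le_right _ _))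
      have h3 := L.sum_endSlope_nonneg (x := L.potQ K (j + 1) - L.potP K (j + 1 + 1)) (by
          rw [h1, potP, if_pos (by omega)]; exact sub_nonneg.2 (min_le_right _ _)) (j + 1)
      omega
    -- Below the truncation level, the chip arriving along the single edge and the chip already
    -- there pay for the two leaving.
    · have h1 := L.neg_two_le_sum_endSlope (L.potQ K (j + 1) - L.potP K (j + 1 + 1)) (j + 1)
      have h2 := endSlope_self hc (x := L.potQ K (j + 1) - L.potP K (j + 1)) (by
        rw [potQ, if_pos (by omega), potP, if_pos h.le, min_eq_left hT.le]
        rw [dist] at hT ⊢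
        rw [min_eq_left (by linarith)]
        ring)
      omega
  -- Here the vertex is `q (K + 1)`, whose only possible loss is one chip along the single edge
  -- towards `p (K + 1)`.
  · have h1 := neg_one_le_endSlope (L.potQ j (j + 1) - L.potP j (j + 1)) (Γ.len (L.c (j + 1)))
    have h2 := L.sum_endSlope_nonneg (x := L.potQ j (j + 1) - L.potP j (j + 1 + 1)) (by
      rw [L.potP_of_lt (by omega), L.potQ_of_lt (by omega), sub_zero]) (j + 1)
    omega
  · rw [L.potP_of_lt (by omega), L.potQ_of_lt (by omega), L.potP_of_lt (by omega), sub_zero]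
    have h1 := endSlope_nonneg (l := Γ.len (L.c (j + 1))) (le_refl (0 : ℝ))
    have h2 := L.sum_endSlope_nonneg (le_refl (0 : ℝ)) (j + 1)
    omega

theorem chips_reach_p {K : ℕ} (hK : K + 1 < n) :
    ∃ D', LinEquiv D' L.chips ∧ Effective D' ∧ 1 ≤ D' (.vertex (L.p (K + 1))) := by
  set h := L.assign (L.potP K) (L.potQ K) with hh
  have hp : ∀ j ≤ n, h (L.p j) = L.potP K j := by
    intro j hj
    rcases hj.eq_or_lt with rfl | hj
    -- The potential is consistent around the cycle: `potP K n` and `potP K 0` both vanish, as `n >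
    -- K + 1`.
    · rw [L.p_period, hh, L.assign_p _ _ (by omega), L.potP_of_lt hK, potP]
    · exact L.assign_p _ _ hj
  have hq : ∀ j ≤ n, h (L.q j) = L.potQ K j := by
    intro j hj
    rcases hj.eq_or_lt with rfl | hj
    · rw [L.q_period, hh, L.assign_q _ _ (by omega), potQ_zero, L.potQ_of_lt (by omega)]
    · exact L.assign_q _ _ hj
  have hstar_p : ∀ j < n, (if j = K then 1 else 0) ≤
      starSum (fun w e => endSlope (h (L.p (j + 1)) - h w) (Γ.len e)) (L.p (j + 1)) := by
    intro j hj
    rw [L.star_p, hp _ hj, hq _ hj, hq _ hj.le]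
    exact L.order_p K j
  have hstar_q : ∀ j < n, 0 ≤ (if j = 0 then 2 else 1) +
      starSum (fun w e => endSlope (h (L.q j) - h w) (Γ.len e)) (L.q j) := by
    intro j hj
    rw [L.star_q, hp _ hj, hq _ hj.le, hp _ hj.le]
    exact L.order_q K j
  obtain ⟨D', h1, h2, h3⟩ := exists_move_potential L.effective_chips (h := h) (by
    intro e
    obtain ⟨j, hj, ⟨rfl, hends⟩ | ⟨s, rfl, hends⟩⟩ := L.edges e
    · rcases hends with ⟨h1, h2⟩ | ⟨h1, h2⟩
      · rw [h1, h2, hp _ hj.le, hq _ hj.le]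
        exact L.abs_potP_sub_potQ K j
      · rw [h1, h2, hp _ hj.le, hq _ hj.le, abs_sub_comm]
        exact L.abs_potP_sub_potQ K j
    · refine le_trans ?_ (L.gap_le j s)
      rcases hends with ⟨h1, h2⟩ | ⟨h1, h2⟩
      · rw [h1, h2, hp _ hj, hq _ hj.le]
        exact L.abs_potQ_sub_potP K j
      · rw [h1, h2, hp _ hj, hq _ hj.le, abs_sub_comm]
        exact L.abs_potQ_sub_potP K j) (by
    intro v
    obtain ⟨j, hj, rfl | rfl⟩ := L.cover v
    · rw [L.chips_p hj, zero_add]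
      rcases j with _ | j
      · obtain ⟨m, rfl⟩ : ∃ m, n = m + 1 := ⟨n - 1, by omega⟩
        have := hstar_p m (Nat.lt_succ_self m)
        rw [L.p_period] at this
        exact le_trans (by split_ifs <;> norm_num) this
      · exact le_trans (by split_ifs <;> norm_num) (hstar_p j (by omega))
    · rw [L.chips_q hj]
      exact hstar_q j hj)
  refine ⟨D', h1, h2, ?_⟩
  rw [h3, L.chips_p hK, zero_add]
  have := hstar_p K (by omega)
  rwa [if_pos rfl] at this

/-- Removing the vertex `p 0` from the set of vertices, one does not get a rank determining
set. -/
theorem not_isRankDetermining (hn : 0 < n) {B : Set Γ.Point}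
    (hB : B ⊆ Set.range Point.vertex) (hp : .vertex (L.p 0) ∉ B) : ¬ IsRankDetermining B := by
  refine MetricGraph.not_isRankDetermining L.effective_chips (fun a ha => ?_)
    fun D' => L.chips_unreachable hn
  obtain ⟨v, rfl⟩ := hB ha
  obtain ⟨j, hj, rfl | rfl⟩ := L.cover v
  · rcases j with _ | j
    · exact absurd ha hp
    · exact L.chips_reach_p hj
  · refine ⟨_, LinEquiv.refl _, L.effective_chips, ?_⟩
    rw [L.chips_q hj]
    split_ifs <;> norm_num

end CyclicLabelling

end MetricGraph

/-! ### Application to loops of loops. -/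

namespace LoopOfLoops
open MetricGraph

variable {g : ℕ} {hg : 3 ≤ g} {len : Edge (g - 1) → ℝ} {hlen : ∀ e, 0 < len e}

theorem starSum_inl (F : Vertex (g - 1) → Edge (g - 1) → ℤ) (i : Fin (g - 1)) :
    starSum (Γ := loopOfLoops g hg len hlen) F (.inl i) = F (.inr i) (.inl i) +
      ∑ s, F (.inr ((finRotate (g - 1)).symm i)) (.inr ((finRotate (g - 1)).symm i, s)) := by
  classical
  unfold starSum
  simp only [Finset.sum_filter]
  simp only [Fintype.sum_sum_type, Fintype.sum_prod_type, src, tgt, Sum.inl.injEq, reduceCtorEq,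
    if_false, Finset.sum_const_zero, add_zero, zero_add, ← Equiv.eq_symm_apply]
  simp [-finRotate_symm_apply]

theorem starSum_inr (F : Vertex (g - 1) → Edge (g - 1) → ℤ) (i : Fin (g - 1)) :
    starSum (Γ := loopOfLoops g hg len hlen) F (.inr i) = F (.inl i) (.inl i) +
      ∑ s, F (.inl (finRotate (g - 1) i)) (.inr (i, s)) := by
  classical
  unfold starSum
  simp only [Finset.sum_filter]
  simp only [Fintype.sum_sum_type, Fintype.sum_prod_type, src, tgt, Sum.inr.injEq, reduceCtorEq,
    if_false, Finset.sum_const_zero, add_zero, zero_add]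
  simp [-finRotate_apply, add_comm]

theorem iterate_finRotate {n : ℕ} [NeZero n] (i : Fin n) (j : ℕ) :
    (finRotate n)^[j] i = i + (Fin.ofNat n j) := by
  induction j with
  | zero => simp
  | succ j ih =>
    rw [Function.iterate_succ_apply', ih, finRotate_apply, add_assoc]
    congr 1
    ext
    simp [Fin.val_add]

theorem iterate_finRotate_symm {n : ℕ} [NeZero n] (i : Fin n) (j : ℕ) :
    (finRotate n).symm^[j] i = i - (Fin.ofNat n j) := by
  rw [eq_sub_iff_add_eq, ← iterate_finRotate]
  exact Function.LeftInverse.iterate (finRotate n).apply_symm_apply j i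

/-- The cyclic permutation `π` enumerates `Fin n`, starting at `i`. -/
def Enumerates {n : ℕ} (π : Equiv.Perm (Fin n)) (i : Fin n) (idx : Fin n → ℕ) : Prop :=
  (∀ a, idx a < n ∧ π^[idx a] i = a) ∧ (∀ j < n, idx (π^[j] i) = j) ∧ π^[n] i = i

theorem enumerates_finRotate {n : ℕ} [NeZero n] (i : Fin n) :
    Enumerates (finRotate n) i fun a => (a - i).val := by
  refine ⟨fun a => ⟨(a - i).isLt, ?_⟩, fun j hj => ?_, ?_⟩
  · rw [iterate_finRotate, Fin.ofNat_val_eq_self, add_sub_cancel]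
  · dsimp only
    rw [iterate_finRotate, add_sub_cancel_left, Fin.val_ofNat, Nat.mod_eq_of_lt hj]
  · rw [iterate_finRotate, Fin.ofNat_self, add_zero]

theorem enumerates_finRotate_symm {n : ℕ} [NeZero n] (i : Fin n) :
    Enumerates (finRotate n).symm i fun a => (i - a).val := by
  refine ⟨fun a => ⟨(i - a).isLt, ?_⟩, fun j hj => ?_, ?_⟩
  · rw [iterate_finRotate_symm, Fin.ofNat_val_eq_self, sub_sub_cancel]
  · dsimp only
    rw [iterate_finRotate_symm, sub_sub_cancel, Fin.val_ofNat, Nat.mod_eq_of_lt hj]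
  · rw [iterate_finRotate_symm, Fin.ofNat_self, sub_zero]

/-- The labelling of a loop of loops starting at a vertex `v_i`. -/
def labellingV (i : Fin (g - 1)) (idx : Fin (g - 1) → ℕ)
    (h : Enumerates (finRotate (g - 1)) i idx) :
    CyclicLabelling (loopOfLoops g hg len hlen) (g - 1) where
  p j := .inl ((finRotate (g - 1))^[j] i)
  q j := .inr ((finRotate (g - 1))^[j] i)
  c j := .inl ((finRotate (g - 1))^[j] i)
  d j s := .inr ((finRotate (g - 1))^[j] i, s)
  p_period := congrArg Sum.inl h.2.2
  q_period := congrArg Sum.inr h.2.2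
  index := Sum.elim idx idx
  isP := Sum.isLeft
  index_p j hj := ⟨h.2.1 j hj, rfl⟩
  index_q j hj := ⟨h.2.1 j hj, rfl⟩
  cover := by
    rintro (a | a)
    · exact ⟨idx a, (h.1 a).1, Or.inl (congrArg Sum.inl (h.1 a).2.symm)⟩
    · exact ⟨idx a, (h.1 a).1, Or.inr (congrArg Sum.inr (h.1 a).2.symm)⟩
  edges := by
    rintro (a | ⟨a, s⟩)
    · refine ⟨idx a, (h.1 a).1, Or.inl ?_⟩
      rw [(h.1 a).2]
      exact ⟨rfl, Or.inl ⟨rfl, rfl⟩⟩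
    · refine ⟨idx a, (h.1 a).1, Or.inr ⟨s, ?_⟩⟩
      rw [Function.iterate_succ_apply', (h.1 a).2]
      exact ⟨rfl, Or.inl ⟨rfl, rfl⟩⟩
  star_p F j := by
    rw [starSum_inl, Function.iterate_succ_apply', Equiv.symm_apply_apply]
  star_q F j := by
    rw [starSum_inr, Function.iterate_succ_apply']

/-- The labelling of a loop of loops starting at a vertex `w_i`, in the opposite direction. -/
def labellingW (i : Fin (g - 1)) (idx : Fin (g - 1) → ℕ)
    (h : Enumerates (finRotate (g - 1)).symm i idx) :
    CyclicLabelling (loopOfLoops g hg len hlen) (g - 1) where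
  p j := .inr ((finRotate (g - 1)).symm^[j] i)
  q j := .inl ((finRotate (g - 1)).symm^[j] i)
  c j := .inl ((finRotate (g - 1)).symm^[j] i)
  -- Double edges are indexed by their end `w`, which in this direction is `p (j + 1)`; hence the
  -- shift by one.
  d j s := .inr ((finRotate (g - 1)).symm^[j + 1] i, s)
  p_period := congrArg Sum.inr h.2.2
  q_period := congrArg Sum.inl h.2.2
  index := Sum.elim idx idx
  isP := Sum.isRight
  index_p j hj := ⟨h.2.1 j hj, rfl⟩
  index_q j hj := ⟨h.2.1 j hj, rfl⟩
  cover := by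
    rintro (a | a)
    · exact ⟨idx a, (h.1 a).1, Or.inr (congrArg Sum.inl (h.1 a).2.symm)⟩
    · exact ⟨idx a, (h.1 a).1, Or.inl (congrArg Sum.inr (h.1 a).2.symm)⟩
  edges := by
    rintro (a | ⟨a, s⟩)
    · refine ⟨idx a, (h.1 a).1, Or.inl ?_⟩
      rw [(h.1 a).2]
      exact ⟨rfl, Or.inr ⟨rfl, rfl⟩⟩
    · refine ⟨idx (finRotate (g - 1) a), (h.1 _).1, Or.inr ⟨s, ?_⟩⟩
      rw [Function.iterate_succ_apply', (h.1 _).2, Equiv.symm_apply_apply]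
      exact ⟨rfl, Or.inr ⟨rfl, rfl⟩⟩
  star_p F j := by
    rw [starSum_inr, Function.iterate_succ_apply', Equiv.apply_symm_apply]
  star_q F j := by
    rw [starSum_inl, Function.iterate_succ_apply']

theorem genus_eq : (loopOfLoops g hg len hlen).genus = g := by
  have h := (loopOfLoops g hg len hlen).genus_add_card
  have hV : Fintype.card (loopOfLoops g hg len hlen).V = (g - 1) + (g - 1) := by
    simp [Fintype.card_sum]
  have hE : Fintype.card (loopOfLoops g hg len hlen).E = (g - 1) + (g - 1) * 2 := by
    simp [Fintype.card_sum]
  omega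

theorem valence_vertex (v : Vertex (g - 1)) :
    (loopOfLoops g hg len hlen).valence (.vertex v) = 3 := by
  classical
  have h : ((loopOfLoops g hg len hlen).valence (.vertex v) : ℤ) =
      starSum (Γ := loopOfLoops g hg len hlen) (fun _ _ => 1) v := by
    simp [valence, starSum]
  have h3 : starSum (Γ := loopOfLoops g hg len hlen) (fun _ _ => 1) v = 3 := by
    rcases v with i | i
    · rw [starSum_inl]; simp
    · rw [starSum_inr]; simp
  exact_mod_cast h.trans h3

theorem vertices_eq_valence : loopOfLoopsVertices g hg len hlen =
    {p | (loopOfLoops g hg len hlen).valence p = 3} := by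
  ext p
  constructor
  · rintro ⟨v, rfl⟩
    exact valence_vertex v
  · rcases p with v | ⟨e, t, ht⟩
    · exact fun _ => ⟨v, rfl⟩
    · intro h
      exact absurd (show 2 = 3 from h) (by norm_num)

theorem vertex_injective : Function.Injective fun x : Vertex (g - 1) =>
    (Point.vertex x : (loopOfLoops g hg len hlen).Point) := fun x y h => by
  cases h; rfl

theorem ncard_vertices : (loopOfLoopsVertices g hg len hlen).ncard = 2 * g - 2 := by
  rw [loopOfLoopsVertices, ← Set.image_univ, Set.ncard_image_of_injective _ vertex_injective,
    Set.ncard_univ, Nat.card_eq_fintype_card, Fintype.card_sum, Fintype.card_fin]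
  omega

theorem isMinimalRankDetermining_vertices :
    IsMinimalRankDetermining (loopOfLoopsVertices g hg len hlen) := by
  have : NeZero (g - 1) := ⟨by omega⟩
  refine ⟨isRankDetermining_vertices (Γ := loopOfLoops g hg len hlen) ?_, fun B hB => ?_⟩
  · rintro (a | ⟨a, s⟩) h
    · exact Sum.inl_ne_inr h
    · exact Sum.inr_ne_inl h
  -- A proper subset omits some vertex, from which the cyclic labelling is started.
  · obtain ⟨_, ⟨v, rfl⟩, hv⟩ := Set.exists_of_ssubset hB
    rcases v with i | i
    · exact (labellingV i _ (enumerates_finRotate i)).not_isRankDetermining (by omega) hB.1 hv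
    · exact (labellingW i _ (enumerates_finRotate_symm i)).not_isRankDetermining (by omega) hB.1 hv

end LoopOfLoops

theorem not_luoConjecture : ¬ LuoConjecture := by
  classical
  intro h
  have hg : 3 ≤ 4 := by norm_num
  have hlen : ∀ e : LoopOfLoops.Edge (4 - 1), (0 : ℝ) < (fun _ => 1 : _ → ℝ) e :=
    fun _ => one_pos
  -- Genus `4` with unit edge lengths gives `6` points, more than `4 + 1`.
  have hfin : (loopOfLoopsVertices 4 hg _ hlen).Finite := Set.finite_range _
  have h1 := h (loopOfLoops 4 hg _ hlen) hfin.toFinset (by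
    rw [Set.Finite.coe_toFinset]
    exact LoopOfLoops.isMinimalRankDetermining_vertices)
  rw [← Set.ncard_eq_toFinset_card _ hfin, LoopOfLoops.ncard_vertices,
    LoopOfLoops.genus_eq] at h1
  omega

theorem mainTheorem5 :
    (∀ (g : ℕ) (hg : 3 ≤ g) (len : LoopOfLoops.Edge (g - 1) → ℝ) (hlen : ∀ e, 0 < len e),
      (loopOfLoops g hg len hlen).genus = g ∧
      loopOfLoopsVertices g hg len hlen =
        {p | (loopOfLoops g hg len hlen).valence p = 3} ∧
      (loopOfLoopsVertices g hg len hlen).ncard = 2 * g - 2 ∧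
      MetricGraph.IsMinimalRankDetermining (loopOfLoopsVertices g hg len hlen) ∧
      (4 ≤ g → g + 1 < (loopOfLoopsVertices g hg len hlen).ncard)) ∧
    ¬ LuoConjecture := by
  refine ⟨fun g hg len hlen => ⟨LoopOfLoops.genus_eq, LoopOfLoops.vertices_eq_valence,
    LoopOfLoops.ncard_vertices, LoopOfLoops.isMinimalRankDetermining_vertices, fun h => ?_⟩,
    not_luoConjecture⟩
  rw [LoopOfLoops.ncard_vertices]
  omega
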